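/- Let $\mathbb K=\mathbb R$ or $\mathbb C$, let $\mathcal F$ denote the sheaf of smooth (for $\mathbb K=\mathbb R$) or holomorphic (for $\mathbb K=\mathbb C$) functions, and fix a parity $\varepsilon\in\mathbb Z_2$. Let $\Delta_n\subset\mathbb Z^n$ be the set of weights $\alpha_{i_1}+\cdots+\alpha_{i_p}$ with distinct indices ("multiplicity-free" weights), where $\alpha_1,\dots,\alpha_n$ are the standard generators. Write $\sharp\delta=p$ for the length of $\delta=\alpha_{i_1}+\cdots+\alpha_{i_p}$. Let $\Delta\subset\Delta_n$ be a subset that contains $0$ and is invariant under the permutation group $S_n$, and let $L=\Delta/S_n=\{\sharp\delta : \delta\in\Delta\}$. For $a=1,2$ let dimensions $n_0^a$ and $n_k^a$ ($k\in L\setminus\{0\}$) and an open set $U_a\subset\mathbb K^{n_0^a}$ be given. They determine: * the graded domain $\mathcal U_a$ of type $L$ with base $U_a$, whose structure sheaf is the (sheaf) tensor product of $\mathcal F_{U_a}$ with the super-symmetric algebra on generators $\xi^k_j$ ($k\in L\setminus\{0\}$, $1\le j\le n^a_k$) of weight $k$ and parity $k\varepsilon$; * the graded domain $\mathcal D_a$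 of type $\Delta$ with base $U_a$, whose structure sheaf is the (sheaf) tensor product of $\mathcal F_{U_a}$ with the super-symmetric algebra on generators $t^\delta_j$ ($\delta\in\Delta\setminus\{0\}$, $1\le j\le n^a_{\sharp\delta}$) of weight $\delta$ and parity $\sharp\delta\,\varepsilon$; * the multiplicity-free domain $\mathcal V_a=(U_a,\mathcal O_{\mathcal D_a}/\mathcal I_a)$ of type $\Delta$, where $\mathcal I_a$ is the ideal sheaf generated by the homogeneous elements whose weight is not in $\Delta_n$. The group $S_n$ acts on $\mathcal O_{\mathcal V_a}$ over the identity of $U_a$ by $s\cdot t^\delta_j=t^{s\cdot\delta}_j$; * the covering projection $\mathsf p_a:\mathcal V_a\to\mathcal U_a$, which is the identity on $U_a$ and satisfies $\mathsf p_a^*(\xi^k_j)=\sum_{\delta\in\Delta,\ \sharp\delta=k}t^\delta_j$. Morphisms of graded domains of type $L$ (respectively of type $\Delta$) are morphisms of $\mathbb Z$-graded (respectively $\mathbb Z^n$-graded) ringed spaces that restrict on functions of weight $0$ to the pull-back along a smooth (holomorphic) map of the bases. Morphisms of multiplicity-free domains $\mathcal V_1\to\mathcal V_2$ are those induced by morphisms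 $\mathcal D_1\to\mathcal D_2$ of graded domains of type $\Delta$. A morphism $\Phi:\mathcal V_1\to\mathcal V_2$ is called $S_n$-invariant if $s\circ\Phi^*=\Phi^*\circ s$ for all $s\in S_n$. The multiplicity-free lift of a morphism $\phi:\mathcal U_1\to\mathcal U_2$ is the unique morphism $\Phi:\mathcal V_1\to\mathcal V_2$ of multiplicity-free domains with $\mathsf p_2\circ\Phi=\phi\circ\mathsf p_1$. **Theorem.** Let $\Phi:\mathcal V_1\to\mathcal V_2$ be an $S_n$-invariant morphism of multiplicity-free domains. Then there exists a unique morphism of graded domains $\phi:\mathcal U_1\to\mathcal U_2$ whose multiplicity-free lift is $\Phi$. -/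

import Mathlib

open TopologicalSpace
open scoped ContDiff

noncomputable section

namespace MultFree

/-! ### Super-symmetric algebras -/

section Algebra

/-- Super-commutativity of generators: `g h = (-1)^{|g||h|} h g`. In characteristic `0` it gives
`g * g = 0` for odd `g`. -/
inductive SuperRel (𝕜 : Type*) [Field 𝕜] {G : Type*} (par : G → ZMod 2) :
    FreeAlgebra 𝕜 G → FreeAlgebra 𝕜 G → Prop
  | swap (g h : G) : SuperRel 𝕜 par (FreeAlgebra.ι 𝕜 g * FreeAlgebra.ι 𝕜 h)
      (((-1 : 𝕜) ^ (par g * par h).val) • (FreeAlgebra.ι 𝕜 h * FreeAlgebra.ι 𝕜 g))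

/-- The super-symmetric algebra `S^*(V)` of the vector superspace `V` with homogeneous basis `G`,
the basis vector `g` having parity `par g`. -/
abbrev SuperSym (𝕜 : Type*) [Field 𝕜] {G : Type*} (par : G → ZMod 2) : Type _ :=
  RingQuot (SuperRel 𝕜 par)

variable {𝕜 : Type*} [Field 𝕜] {G : Type*} {par : G → ZMod 2}

/-- The basis vector `g`, as an element of the super-symmetric algebra. -/
def superGen (par : G → ZMod 2) (g : G) : SuperSym 𝕜 par :=
  RingQuot.mkAlgHom 𝕜 (SuperRel 𝕜 par) (FreeAlgebra.ι 𝕜 g)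

theorem superGen_swap (g h : G) :
    (superGen par g : SuperSym 𝕜 par) * superGen par h =
      ((-1 : 𝕜) ^ (par g * par h).val) • (superGen par h * superGen par g) := by
  have := RingQuot.mkAlgHom_rel 𝕜 (SuperRel.swap (𝕜 := 𝕜) (par := par) g h)
  simpa [superGen] using this

/-- The algebra homomorphism out of `S^*(V)` with prescribed values on the basis. -/
def superLift {A : Type*} [Semiring A] [Algebra 𝕜 A] (v : G → A)
    (hv : ∀ g h, v g * v h = ((-1 : 𝕜) ^ (par g * par h).val) • (v h * v g)) :
    SuperSym 𝕜 par →ₐ[𝕜] A :=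
  RingQuot.liftAlgHom 𝕜 ⟨FreeAlgebra.lift 𝕜 v, by
    rintro _ _ ⟨g, h⟩
    simpa using hv g h⟩

@[simp] theorem superLift_gen {A : Type*} [Semiring A] [Algebra 𝕜 A] (v : G → A)
    (hv : ∀ g h, v g * v h = ((-1 : 𝕜) ^ (par g * par h).val) • (v h * v g)) (g : G) :
    superLift v hv (superGen par g) = v g := by
  simp [superLift, superGen]

/-- The homogeneous component of weight `w` of `S^*(V)`: the span of the monomials
`g₁ ⋯ g_r` with `wt g₁ + ⋯ + wt g_r = w`. -/
def superComp (𝕜 : Type*) [Field 𝕜] {G : Type*} (par : G → ZMod 2) {M : Type*} [AddCommMonoid M]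
    (wt : G → M) (w : M) : Submodule 𝕜 (SuperSym 𝕜 par) :=
  Submodule.span 𝕜 {a | ∃ l : List G, (l.map wt).sum = w ∧ (l.map (superGen par)).prod = a}

/-- The coarser grading obtained from a grading `c` by the map of weights `ℓ`. -/
def coarsen {A M N : Type*} [AddCommMonoid A] [Module 𝕜 A] (ℓ : M → N) (c : M → Submodule 𝕜 A)
    (k : N) : Submodule 𝕜 A :=
  ⨆ (w : M) (_ : ℓ w = k), c w

theorem superComp_mul {M : Type*} [AddCommMonoid M] (wt : G → M) (v w : M) :
    superComp 𝕜 par wt v * superComp 𝕜 par wt w ≤ superComp 𝕜 par wt (v + w) := by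
  rw [superComp, superComp, Submodule.span_mul_span]
  refine Submodule.span_mono ?_
  rintro _ ⟨_, ⟨l, rfl, rfl⟩, _, ⟨l', rfl, rfl⟩, rfl⟩
  exact ⟨l ++ l', by simp, by simp⟩

theorem coarsen_mul {A M N : Type*} [Semiring A] [Algebra 𝕜 A] [AddCommMonoid M]
    [AddCommMonoid N] (ℓ : M →+ N) (c : M → Submodule 𝕜 A)
    (hc : ∀ v w, c v * c w ≤ c (v + w)) (i j : N) :
    coarsen ℓ c i * coarsen ℓ c j ≤ coarsen ℓ c (i + j) := by
  simp only [coarsen, Submodule.iSup_mul, Submodule.mul_iSup, iSup_le_iff]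
  intro v hv w hw
  refine (hc _ _).trans ?_
  exact le_iSup₂_of_le (f := fun (u : M) (_ : ℓ u = i + j) => c u) _ (by simp [*]) le_rfl

end Algebra

/-! ### Ringed spaces over open sets -/

section Sheaf

variable {𝕜 : Type*} [RCLike 𝕜]

/-- `σ : W → A` is locally a finite sum `∑ fᵢ aᵢ` with `fᵢ` smooth (holomorphic for `𝕜 = ℂ`)
functions and `aᵢ ∈ A`. -/
def IsSection {m : ℕ} (U : Opens (Fin m → 𝕜)) (A : Type*) [Semiring A] [Algebra 𝕜 A] (W : Opens U)
    (σ : W → A) : Prop :=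
  ∀ x : W, ∃ N : Set (Fin m → 𝕜), IsOpen N ∧ ((x : U) : Fin m → 𝕜) ∈ N ∧
    ∃ (ι : Type) (_ : Fintype ι) (f : ι → (Fin m → 𝕜) → 𝕜) (a : ι → A),
      (∀ i, ContDiffOn 𝕜 ∞ (f i) N) ∧
      ∀ y : W, ((y : U) : Fin m → 𝕜) ∈ N → σ y = ∑ i, f i ((y : U) : Fin m → 𝕜) • a i

/-- The sections over `W ⊆ U` of the sheaf `ℱ_U ⊗ A`, where `ℱ_U` is the sheaf of smooth
(holomorphic) functions and `A` is an algebra of constants. The tensor product is one of sheaves,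
so a section is a function with values in `A` that is only locally a finite sum
`∑ fᵢ ⊗ aᵢ`. For `A = S^*(V_{>0})` it is `ℱ_U ⊗_{S^*(V_0)} S^*(V)`, because
`S^*(V) = S^*(V_0) ⊗ S^*(V_{>0})`. -/
def sections {m : ℕ} (U : Opens (Fin m → 𝕜)) (A : Type*) [Semiring A] [Algebra 𝕜 A] (W : Opens U) :
    Subalgebra 𝕜 (W → A) where
  carrier := {σ | IsSection U A W σ}
  mul_mem' := by
    rintro σ τ hσ hτ x
    obtain ⟨N, hN, hx, ι, _, f, a, hf, h⟩ := hσ x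
    obtain ⟨N', hN', hx', ι', _, f', a', hf', h'⟩ := hτ x
    refine ⟨N ∩ N', hN.inter hN', ⟨hx, hx'⟩, ι × ι', inferInstance,
      fun p y => f p.1 y * f' p.2 y, fun p => a p.1 * a' p.2, ?_, ?_⟩
    · intro p
      exact ((hf p.1).mono Set.inter_subset_left).mul ((hf' p.2).mono Set.inter_subset_right)
    · intro y hy
      rw [Pi.mul_apply, h y hy.1, h' y hy.2, Finset.sum_mul_sum, Fintype.sum_prod_type]
      simp only [smul_mul_smul_comm]
  add_mem' := by
    rintro σ τ hσ hτ x
    obtain ⟨N, hN, hx, ι, _, f, a, hf, h⟩ := hσ x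
    obtain ⟨N', hN', hx', ι', _, f', a', hf', h'⟩ := hτ x
    refine ⟨N ∩ N', hN.inter hN', ⟨hx, hx'⟩, ι ⊕ ι', inferInstance,
      Sum.elim f f', Sum.elim a a', ?_, ?_⟩
    · rintro (i | i)
      · exact (hf i).mono Set.inter_subset_left
      · exact (hf' i).mono Set.inter_subset_right
    · intro y hy
      rw [Pi.add_apply, h y hy.1, h' y hy.2, Fintype.sum_sum_type]
      simp
  algebraMap_mem' := by
    intro c x
    refine ⟨Set.univ, isOpen_univ, trivial, Unit, inferInstance, fun _ _ => c, fun _ => 1,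
      fun _ => contDiffOn_const, fun y _ => ?_⟩
    simp [Algebra.algebraMap_eq_smul_one]

/-- Restriction of sections. -/
def res {m : ℕ} {U : Opens (Fin m → 𝕜)} {A : Type*} [Semiring A] [Algebra 𝕜 A] {W W' : Opens U}
    (h : W' ≤ W) (σ : sections U A W) : sections U A W' :=
  ⟨fun y => σ.1 ⟨y.1, h y.2⟩, by
    intro x
    obtain ⟨N, hN, hx, ι, i, f, a, hf, hs⟩ := σ.2 ⟨x.1, h x.2⟩
    exact ⟨N, hN, hx, ι, i, f, a, hf, fun y hy => hs ⟨y.1, h y.2⟩ hy⟩⟩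

/-- A homomorphism `A → B` of algebras of constants acts on sections. -/
def mapSections {m : ℕ} {U : Opens (Fin m → 𝕜)} {A B : Type*} [Semiring A] [Algebra 𝕜 A] [Semiring B]
    [Algebra 𝕜 B] (q : A →ₐ[𝕜] B) (W : Opens U) : sections U A W →ₐ[𝕜] sections U B W where
  toFun σ := ⟨fun y => q (σ.1 y), by
    intro x
    obtain ⟨N, hN, hx, ι, i, f, a, hf, hs⟩ := σ.2 x
    refine ⟨N, hN, hx, ι, i, f, fun j => q (a j), hf, fun y hy => ?_⟩
    change q (σ.1 y) = _
    rw [hs y hy]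
    simp⟩
  map_one' := by ext; simp
  map_mul' _ _ := by ext; simp
  map_zero' := by ext; simp
  map_add' _ _ := by ext; simp
  commutes' c := by
    ext y
    exact q.commutes c

/-- A morphism `(U₁, ℱ ⊗ A₁) → (U₂, ℱ ⊗ A₂)` of ringed spaces over `𝕜` that is a usual morphism of
smooth (holomorphic) domains on the subsheaves `ℱ = ℱ ⊗ 1`: the base map is smooth and functions
are pulled back along it. -/
structure RingedMor {m₁ m₂ : ℕ} (U₁ : Opens (Fin m₁ → 𝕜)) (A₁ : Type*) [Semiring A₁] [Algebra 𝕜 A₁]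
    (U₂ : Opens (Fin m₂ → 𝕜)) (A₂ : Type*) [Semiring A₂] [Algebra 𝕜 A₂] where
  base : C(U₁, U₂)
  smooth_base : ∃ g : (Fin m₁ → 𝕜) → (Fin m₂ → 𝕜), ContDiffOn 𝕜 ∞ g U₁ ∧
    ∀ x : U₁, g x = base x
  pullback : ∀ W : Opens U₂, sections U₂ A₂ W →ₐ[𝕜] sections U₁ A₁ (Opens.comap base W)
  pullback_res : ∀ {W W' : Opens U₂} (h : W' ≤ W) (σ : sections U₂ A₂ W),
    pullback W' (res h σ) =
      res (W := Opens.comap base W) (W' := Opens.comap base W') (fun _ hx => h hx) (pullback W σ)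
  pullback_function : ∀ (W : Opens U₂) (σ : sections U₂ A₂ W) (f : W → 𝕜),
    (∀ y, σ.1 y = algebraMap 𝕜 A₂ (f y)) →
      ∀ x, (pullback W σ).1 x = algebraMap 𝕜 A₁ (f ⟨base x.1, x.2⟩)

/-- Composition of morphisms of ringed spaces (first `Φ`, then `Ψ`). -/
def RingedMor.comp {m₁ m₂ m₃ : ℕ} {U₁ : Opens (Fin m₁ → 𝕜)} {A₁ : Type*} [Semiring A₁] [Algebra 𝕜 A₁]
    {U₂ : Opens (Fin m₂ → 𝕜)} {A₂ : Type*} [Semiring A₂] [Algebra 𝕜 A₂]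
    {U₃ : Opens (Fin m₃ → 𝕜)} {A₃ : Type*} [Semiring A₃] [Algebra 𝕜 A₃]
    (Ψ : RingedMor U₂ A₂ U₃ A₃) (Φ : RingedMor U₁ A₁ U₂ A₂) : RingedMor U₁ A₁ U₃ A₃ where
  base := Ψ.base.comp Φ.base
  smooth_base := by
    obtain ⟨g, hg, hg'⟩ := Φ.smooth_base
    obtain ⟨k, hk, hk'⟩ := Ψ.smooth_base
    refine ⟨k ∘ g, hk.comp hg ?_, ?_⟩
    · intro x hx
      have := hg' ⟨x, hx⟩
      simp only at this
      rw [this]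
      exact (Φ.base ⟨x, hx⟩).2
    · intro x
      simp [hg', hk']
  pullback W := (Φ.pullback (Opens.comap Ψ.base W)).comp (Ψ.pullback W)
  pullback_res {W W'} h σ :=
    (congrArg (Φ.pullback (Opens.comap Ψ.base W')) (Ψ.pullback_res h σ)).trans
      (Φ.pullback_res (W := Opens.comap Ψ.base W) (W' := Opens.comap Ψ.base W')
        (fun _ hx => h hx) (Ψ.pullback W σ))
  pullback_function W σ f hf x :=
    Φ.pullback_function (Opens.comap Ψ.base W) (Ψ.pullback W σ)
      (fun y => f ⟨Ψ.base y.1, y.2⟩) (Ψ.pullback_function W σ f hf) x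

/-- The morphism preserves weights: sections that are homogeneous of weight `w` (that is, take
values in the component of weight `w`) are sent to such sections. -/
def RingedMor.PreservesWeights {m₁ m₂ : ℕ} {U₁ : Opens (Fin m₁ → 𝕜)} {A₁ : Type*} [Semiring A₁]
    [Algebra 𝕜 A₁] {U₂ : Opens (Fin m₂ → 𝕜)} {A₂ : Type*} [Semiring A₂] [Algebra 𝕜 A₂] {M : Type*}
    (Φ : RingedMor U₁ A₁ U₂ A₂) (c₁ : M → Submodule 𝕜 A₁) (c₂ : M → Submodule 𝕜 A₂) : Prop :=
  ∀ (w : M) (W : Opens U₂) (σ : sections U₂ A₂ W),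
    (∀ y, σ.1 y ∈ c₂ w) → ∀ x, (Φ.pullback W σ).1 x ∈ c₁ w

/-- The morphism over the identity of `U` induced by a homomorphism of algebras of constants. -/
def RingedMor.ofAlgHom {m : ℕ} (U : Opens (Fin m → 𝕜)) {A B : Type*} [Semiring A] [Algebra 𝕜 A]
    [Semiring B] [Algebra 𝕜 B] (q : A →ₐ[𝕜] B) : RingedMor U B U A where
  base := ContinuousMap.id U
  smooth_base := ⟨id, contDiffOn_id, fun _ => rfl⟩
  pullback W := mapSections q W
  pullback_res _ _ := rfl
  pullback_function W σ f hf x := by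
    change q (σ.1 x) = _
    rw [hf x]
    exact q.commutes _

end Sheaf

/-! ### Weight systems and coordinates -/

/-- An `S_n`-invariant multiplicity-free weight system `Δ ⊆ Δ_n`. The weight
`α_{i₁} + ⋯ + α_{i_p}` (with distinct indices) is the finite set `{i₁, …, i_p}`; its length is the
cardinality. -/
structure WeightSystem (n : ℕ) where
  weights : Finset (Finset (Fin n))
  zero_mem : ∅ ∈ weights
  invariant : ∀ (s : Equiv.Perm (Fin n)), ∀ δ ∈ weights, δ.map s.toEmbedding ∈ weights

/-- `L = Δ / S_n`: the orbit of `δ` is identified with its length. -/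
def WeightSystem.lengths {n : ℕ} (Δ : WeightSystem n) : Set ℕ :=
  {k | ∃ δ ∈ Δ.weights, δ.card = k}

/-- Dimensions `n_k` (those with `k ∈ L` matter) and an open set in the space of dimension `n_0`.
They determine a graded domain of type `L`, and a domain of type `Δ` whose coordinates
`t_j^δ`, `j = 1, …, n_{♯δ}`, are permuted by `S_n`. -/
structure Shape (𝕜 : Type*) [RCLike 𝕜] where
  dim : ℕ → ℕ
  space : Opens (Fin (dim 0) → 𝕜)

section Coordinates

variable {𝕜 : Type*} [RCLike 𝕜] {n : ℕ}

/-- The indices `(k, j)` of the coordinates `ξ_j^k`, `k ∈ L \ {0}`, `j = 1, …, n_k`. -/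
abbrev XiIndex (Δ : WeightSystem n) (X : Shape 𝕜) : Type :=
  Σ k : {k : ℕ // k ∈ Δ.lengths ∧ k ≠ 0}, Fin (X.dim k)

/-- The indices `((k, j), δ)` of the coordinates `t_j^δ`, where `δ ∈ Δ` and `♯δ = k ≠ 0`. -/
abbrev TIndex (Δ : WeightSystem n) (X : Shape 𝕜) : Type :=
  Σ g : XiIndex Δ X, {δ : Finset (Fin n) // δ ∈ Δ.weights ∧ δ.card = g.1}

variable (Δ : WeightSystem n) (ε : ZMod 2) (X : Shape 𝕜)

/-- `|ξ_j^k| = k|β|` with `|β| = ε`. -/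
def xiParity (g : XiIndex Δ X) : ZMod 2 := ((g.1 : ℕ) : ZMod 2) * ε

/-- `|t_j^δ| = |δ| = ♯δ |α_i|` with `|α_i| = ε`. -/
def tParity (t : TIndex Δ X) : ZMod 2 := (t.2.1.card : ZMod 2) * ε

/-- The weight `k` of `ξ_j^k`. -/
def xiWeight (g : XiIndex Δ X) : ℕ := g.1

/-- The weight `δ` of `t_j^δ`, as a vector of multiplicities of `α₁, …, α_n`. -/
def tWeight (t : TIndex Δ X) : Fin n → ℕ := fun i => if i ∈ t.2.1 then 1 else 0

/-! ### The three algebras of constants and their gradings -/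

/-- `S^*(V_{>0})` for the graded domain `𝒰` of type `L`. -/
abbrev AlgU : Type _ := SuperSym 𝕜 (xiParity Δ ε X)

/-- The weight components of `AlgU`. -/
def compU : ℕ → Submodule 𝕜 (AlgU Δ ε X) := superComp 𝕜 (xiParity Δ ε X) (xiWeight Δ X)

/-- `S^*(V_{>0})` for the graded domain `𝒟` of type `Δ`. -/
abbrev AlgD : Type _ := SuperSym 𝕜 (tParity Δ ε X)

/-- The weight components of `AlgD`. -/
def compD : (Fin n → ℕ) → Submodule 𝕜 (AlgD Δ ε X) :=
  superComp 𝕜 (tParity Δ ε X) (tWeight Δ X)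

/-- A weight is multiplicity-free if all its coefficients are `0` or `1`. -/
def IsMultFreeWeight (w : Fin n → ℕ) : Prop := ∀ i, w i ≤ 1

/-- Elements that are homogeneous of a weight which is not multiplicity-free are set to `0`. -/
inductive NonMultFreeRel : AlgD Δ ε X → AlgD Δ ε X → Prop
  | zero (w : Fin n → ℕ) (hw : ¬ IsMultFreeWeight w) (a : AlgD Δ ε X) (ha : a ∈ compD Δ ε X w) :
      NonMultFreeRel a 0

/-- The quotient of `AlgD` by the ideal generated by the non-multiplicity-free elements. The
structure sheaf `𝒪_𝒟 / ℐ_𝒟` of the multiplicity-free domain `𝒱` is `ℱ ⊗ AlgV`. -/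
abbrev AlgV : Type _ := RingQuot (NonMultFreeRel Δ ε X)

/-- The quotient map. -/
def toV : AlgD Δ ε X →ₐ[𝕜] AlgV Δ ε X := RingQuot.mkAlgHom 𝕜 (NonMultFreeRel Δ ε X)

/-- The coordinate `t_j^δ` in the multiplicity-free domain. -/
def tGen (t : TIndex Δ X) : AlgV Δ ε X := toV Δ ε X (superGen _ t)

/-- The `ℤ^n`-grading of `AlgV`. -/
def compV (w : Fin n → ℕ) : Submodule 𝕜 (AlgV Δ ε X) :=
  (compD Δ ε X w).map (toV Δ ε X).toLinearMap

/-- The `ℤ`-grading of `AlgV` by length. (Components of weights that are not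
multiplicity-free vanish.) -/
def lengthCompV : ℕ → Submodule 𝕜 (AlgV Δ ε X) :=
  coarsen (fun w : Fin n → ℕ => ∑ i, w i) (compV Δ ε X)

/-! ### The action of the permutation group -/

variable {Δ X}

/-- `s · t_j^δ = t_j^{s · δ}` on indices. -/
def permIndex (s : Equiv.Perm (Fin n)) (t : TIndex Δ X) : TIndex Δ X :=
  ⟨t.1, t.2.1.map s.toEmbedding, Δ.invariant s _ t.2.2.1, by
    rw [Finset.card_map]; exact t.2.2.2⟩

theorem tParity_permIndex (s : Equiv.Perm (Fin n)) (t : TIndex Δ X) :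
    tParity Δ ε X (permIndex s t) = tParity Δ ε X t := by
  simp [tParity, permIndex]

theorem tWeight_permIndex (s : Equiv.Perm (Fin n)) (t : TIndex Δ X) :
    tWeight Δ X (permIndex s t) = tWeight Δ X t ∘ s.symm := by
  funext i
  simp [tWeight, permIndex, Finset.mem_map_equiv]

/-- The action of `s` on `AlgD`. -/
def permD (s : Equiv.Perm (Fin n)) : AlgD Δ ε X →ₐ[𝕜] AlgD Δ ε X :=
  superLift (fun t => superGen _ (permIndex s t)) (by
    intro g h
    have := superGen_swap (𝕜 := 𝕜) (par := tParity Δ ε X) (permIndex s g) (permIndex s h)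
    rwa [tParity_permIndex, tParity_permIndex] at this)

theorem permD_mem (s : Equiv.Perm (Fin n)) {w : Fin n → ℕ} {a : AlgD Δ ε X}
    (ha : a ∈ compD Δ ε X w) : permD ε s a ∈ compD Δ ε X (w ∘ s.symm) := by
  refine (Submodule.span_le (p := (compD Δ ε X (w ∘ s.symm)).comap (permD ε s).toLinearMap)).2
    ?_ ha
  rintro _ ⟨l, rfl, rfl⟩
  refine Submodule.subset_span ⟨l.map (permIndex s), ?_, ?_⟩
  · clear ha
    induction l with
    | nil => rfl
    | cons t l ih =>
      simp only [List.map_cons, List.sum_cons, tWeight_permIndex] at ih ⊢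
      rw [ih]
      rfl
  · simp [permD, map_list_prod, Function.comp_def]

/-- The action of `s` on `AlgV`: the algebra homomorphism with `s · t_j^δ = t_j^{s · δ}`. -/
def permV (s : Equiv.Perm (Fin n)) : AlgV Δ ε X →ₐ[𝕜] AlgV Δ ε X :=
  RingQuot.liftAlgHom 𝕜 ⟨(toV Δ ε X).comp (permD ε s), by
    rintro _ _ ⟨w, hw, a, ha⟩
    have hw' : ¬ IsMultFreeWeight (w ∘ s.symm) := fun h => hw fun i => by
      simpa using h (s i)
    have := RingQuot.mkAlgHom_rel 𝕜 (NonMultFreeRel.zero _ hw' _ (permD_mem ε s ha))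
    simpa [toV] using this⟩

@[simp] theorem permV_tGen (s : Equiv.Perm (Fin n)) (t : TIndex Δ X) :
    permV ε s (tGen Δ ε X t) = tGen Δ ε X (permIndex s t) := by
  simp [permV, tGen, toV, permD]

/-! ### The covering projection -/

variable (Δ X)

/-- `𝗉^* ξ_j^k = ∑_{♯δ = k} t_j^δ`. -/
def coverVal (g : XiIndex Δ X) : AlgV Δ ε X :=
  ∑ δ : {δ : Finset (Fin n) // δ ∈ Δ.weights ∧ δ.card = g.1}, tGen Δ ε X ⟨g, δ⟩

/-- The algebra homomorphism with `ξ_j^k ↦ ∑_{♯δ = k} t_j^δ`. -/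
def coverAlg : AlgU Δ ε X →ₐ[𝕜] AlgV Δ ε X :=
  superLift (coverVal Δ ε X) (by
    intro g h
    simp only [coverVal, Finset.sum_mul_sum]
    rw [Finset.sum_comm, Finset.smul_sum]
    refine Finset.sum_congr rfl fun δ' _ => ?_
    rw [Finset.smul_sum]
    refine Finset.sum_congr rfl fun δ _ => ?_
    have := congrArg (toV Δ ε X)
      (superGen_swap (𝕜 := 𝕜) (par := tParity Δ ε X) ⟨g, δ⟩ ⟨h, δ'⟩)
    simp only [map_mul, map_smul] at this
    have e1 : tParity Δ ε X ⟨g, δ⟩ = xiParity Δ ε X g := by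
      simp [tParity, xiParity, δ.2.2]
    have e2 : tParity Δ ε X ⟨h, δ'⟩ = xiParity Δ ε X h := by
      simp [tParity, xiParity, δ'.2.2]
    rw [e1, e2] at this
    exact this)

@[simp] theorem coverAlg_gen (g : XiIndex Δ X) :
    coverAlg Δ ε X (superGen _ g) = coverVal Δ ε X g := by
  simp [coverAlg]

/-- The covering projection `𝗉 : 𝒱 → 𝒰`: `x_i ↦ y_i`, `ξ_j^k ↦ ∑_{♯δ = k} t_j^δ`. -/
def cover : RingedMor X.space (AlgV Δ ε X) X.space (AlgU Δ ε X) :=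
  RingedMor.ofAlgHom X.space (coverAlg Δ ε X)

theorem tGen_mem (t : TIndex Δ X) : tGen Δ ε X t ∈ lengthCompV Δ ε X t.2.1.card := by
  have h : tGen Δ ε X t ∈ compV Δ ε X (tWeight Δ X t) :=
    ⟨superGen _ t, Submodule.subset_span ⟨[t], by simp, by simp⟩, rfl⟩
  exact Submodule.mem_iSup_of_mem _ (Submodule.mem_iSup_of_mem (by simp [tWeight]) h)

theorem lengthCompV_mul (i j : ℕ) :
    lengthCompV Δ ε X i * lengthCompV Δ ε X j ≤ lengthCompV Δ ε X (i + j) := by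
  refine coarsen_mul (ℓ := ⟨⟨fun w : Fin n → ℕ => ∑ i, w i, by simp⟩, fun v w => by
    simp [Finset.sum_add_distrib]⟩) (compV Δ ε X) (fun v w => ?_) i j
  rw [compV, compV, ← Submodule.map_mul]
  exact Submodule.map_mono (superComp_mul _ _ _)

/-- The covering projection is `ℤ`-graded with respect to the length of weights on `𝒱`. -/
theorem cover_preservesWeights :
    (cover Δ ε X).PreservesWeights (lengthCompV Δ ε X) (compU Δ ε X) := by
  intro k W σ hσ x
  refine (Submodule.span_le (p := (lengthCompV Δ ε X k).comap (coverAlg Δ ε X).toLinearMap)).2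
    ?_ (hσ x)
  rintro _ ⟨l, rfl, rfl⟩
  change coverAlg Δ ε X _ ∈ lengthCompV Δ ε X _
  clear hσ
  induction l with
  | nil =>
    refine Submodule.mem_iSup_of_mem 0 (Submodule.mem_iSup_of_mem (by simp) ?_)
    exact ⟨1, Submodule.subset_span ⟨[], by simp, by simp⟩, by simp⟩
  | cons g l ih =>
    rw [List.map_cons, List.map_cons, List.sum_cons, List.prod_cons, map_mul]
    refine lengthCompV_mul Δ ε X _ _ (Submodule.mul_mem_mul ?_ ih)
    rw [coverAlg_gen]
    refine Submodule.sum_mem _ fun δ _ => ?_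
    have := tGen_mem Δ ε X ⟨g, δ⟩
    rwa [δ.2.2] at this

end Coordinates

/-! ### Morphisms of domains -/

section Morphisms

variable {𝕜 : Type*} [RCLike 𝕜] {n : ℕ} (Δ : WeightSystem n) (ε : ZMod 2) (X Y : Shape 𝕜)

/-- Morphisms `𝒰₁ → 𝒰₂` of graded domains of type `L = Δ / S_n`. -/
def GradedMor : Type _ :=
  {φ : RingedMor X.space (AlgU Δ ε X) Y.space (AlgU Δ ε Y) //
    φ.PreservesWeights (compU Δ ε X) (compU Δ ε Y)}

/-- Morphisms `𝒟₁ → 𝒟₂` of graded domains of type `Δ`. -/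
def DeltaMor : Type _ :=
  {Ψ : RingedMor X.space (AlgD Δ ε X) Y.space (AlgD Δ ε Y) //
    Ψ.PreservesWeights (compD Δ ε X) (compD Δ ε Y)}

/-- Morphisms `𝒱₁ → 𝒱₂` of multiplicity-free domains of type `Δ`: the morphisms of `ℤ^n`-graded
ringed spaces that a morphism `Ψ : 𝒟₁ → 𝒟₂` of graded domains of type `Δ` induces on the quotients
by the ideals of non-multiplicity-free elements. -/
def MultFreeMor : Type _ :=
  {Φ : RingedMor X.space (AlgV Δ ε X) Y.space (AlgV Δ ε Y) //
    Φ.PreservesWeights (compV Δ ε X) (compV Δ ε Y) ∧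
    ∃ Ψ : DeltaMor Δ ε X Y,
      (RingedMor.ofAlgHom Y.space (toV Δ ε Y)).comp Φ =
        Ψ.1.comp (RingedMor.ofAlgHom X.space (toV Δ ε X))}

variable {Δ ε X Y}

/-- `Φ` is `S_n`-invariant: `s ∘ Φ^* = Φ^* ∘ s` for all `s ∈ S_n`. -/
def MultFreeMor.IsInvariant (Φ : MultFreeMor Δ ε X Y) : Prop :=
  ∀ (s : Equiv.Perm (Fin n)) (W : Opens Y.space) (σ : sections Y.space (AlgV Δ ε Y) W),
    mapSections (permV ε s) _ (Φ.1.pullback W σ) = Φ.1.pullback W (mapSections (permV ε s) W σ)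

/-- `Φ` is the multiplicity-free lift of `φ`: the unique morphism `𝒱₁ → 𝒱₂` of multiplicity-free
domains with `𝗉₂ ∘ Φ = φ ∘ 𝗉₁`. -/
def IsMultFreeLift (φ : GradedMor Δ ε X Y) (Φ : MultFreeMor Δ ε X Y) : Prop :=
  (cover Δ ε Y).comp Φ.1 = φ.1.comp (cover Δ ε X) ∧
    ∀ Φ' : MultFreeMor Δ ε X Y, (cover Δ ε Y).comp Φ'.1 = φ.1.comp (cover Δ ε X) → Φ' = Φ

end Morphisms

end MultFree

end

/-! A section is locally a finite sum of functions times constants, and functions pull back along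
the base map, so a morphism amounts to its base map together with a smooth family of algebra
homomorphisms, one over each point (`RingedMor.pullback_apply`, `RingedMor.ofFiber`). The theorem
thereby becomes a question about algebras of constants: the image of a generator `ξ` of weight `k`
under `φ^*` has to be an element of weight `k` whose pull-back to the covering is `Φ^* (𝗉₂^* ξ)`.
That element is `S_n`-invariant of length `k`, and two facts finish the proof.

Existence of the preimage (`exists_coverAlg_eq_of_invariant`): an invariant is `1/n!` times its
orbit sum. A monomial in the `t_j^δ` vanishes unless the `δ`s are disjoint, and `S_n` acts
transitively on disjoint families with prescribed sizes. Hence the orbit sum of a monomial is a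
multiple of the pull-back of the corresponding monomial in the `ξ_j^k`.

Uniqueness of the preimage (`coverAlg_injOn`): map `t_j^δ` to `ξ_j^{♯δ} ⊗ x^δ`, where all `x_i² =
0`. The pull-back of `ξ_j^k` then goes to `ξ_j^k / k! ⊗ e^k` with `e = ∑ x_i`. So an element of
weight `k` goes to a rescaled copy of itself tensored with `e^k`, and `e^k ≠ 0` for `k ≤ n`. All
generators have weight at most `n`.

A linear left inverse of the pull-back in weight `k`, the same for all points of the base, turns
preimages into smooth sections. Finally, `Φ` is the only lift of `φ` because the summands of the
pull-back of `ξ_j^k` have distinct weights (`eq_of_sum_eq_of_mem_compV`). -/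

noncomputable section

namespace MultFree

/-! ### Morphisms as smooth families of homomorphisms over points -/

section Pointwise

variable {𝕜 : Type*} [RCLike 𝕜]

/-- Constant sections. -/
def constSection {m : ℕ} {U : Opens (Fin m → 𝕜)} {A : Type*} [Semiring A] [Algebra 𝕜 A]
    (W : Opens U) : A →ₐ[𝕜] sections U A W where
  toFun a := ⟨fun _ => a, fun x => ⟨Set.univ, isOpen_univ, trivial, Unit, inferInstance,
    fun _ _ => 1, fun _ => a, fun _ => contDiffOn_const, fun y _ => by simp⟩⟩
  map_one' := rfl
  map_mul' _ _ := rfl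
  map_zero' := rfl
  map_add' _ _ := rfl
  commutes' _ := rfl

variable {m₁ m₂ : ℕ} {U₁ : Opens (Fin m₁ → 𝕜)} {A₁ : Type*} [Semiring A₁] [Algebra 𝕜 A₁]
  {U₂ : Opens (Fin m₂ → 𝕜)} {A₂ : Type*} [Semiring A₂] [Algebra 𝕜 A₂]

/-- The homomorphism of algebras of constants which a morphism induces over the point `x`. -/
def RingedMor.fiber (Φ : RingedMor U₁ A₁ U₂ A₂) (x : U₁) : A₂ →ₐ[𝕜] A₁ where
  toFun a := (Φ.pullback ⊤ (constSection ⊤ a)).1 ⟨x, trivial⟩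
  map_one' := by rw [map_one, map_one]; rfl
  map_mul' a b := by rw [map_mul, map_mul]; rfl
  map_zero' := by rw [map_zero, map_zero]; rfl
  map_add' a b := by rw [map_add, map_add]; rfl
  commutes' c := by rw [AlgHom.commutes, AlgHom.commutes]; rfl

theorem RingedMor.isSection_fiber (Φ : RingedMor U₁ A₁ U₂ A₂) (a : A₂) :
    IsSection U₁ A₁ ⊤ fun x : (⊤ : Opens U₁) => Φ.fiber x.1 a :=
  (Φ.pullback ⊤ (constSection ⊤ a)).2

/-- Morphisms act on sections pointwise. -/
theorem RingedMor.pullback_apply (Φ : RingedMor U₁ A₁ U₂ A₂) (W : Opens U₂)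
    (σ : sections U₂ A₂ W) (x : Opens.comap Φ.base W) :
    (Φ.pullback W σ).1 x = Φ.fiber x.1 (σ.1 ⟨Φ.base x.1, x.2⟩) := by
  obtain ⟨N, hN, hx, ι, _, f, a, hf, h⟩ := σ.2 ⟨Φ.base x.1, x.2⟩
  -- On this smaller neighbourhood `σ` is a finite sum of products of functions and constants, and
  -- the pull-back of either kind of factor is known.
  let W' : Opens U₂ := W ⊓ ⟨Subtype.val ⁻¹' N, hN.preimage continuous_subtype_val⟩
  have hW' : W' ≤ W := inf_le_left
  have hx' : Φ.base x.1 ∈ W' := ⟨x.2, hx⟩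
  let F : ι → sections U₂ A₂ W' := fun i =>
    ⟨fun y => algebraMap 𝕜 A₂ (f i ((y : U₂) : Fin m₂ → 𝕜)), fun y =>
      ⟨N, hN, y.2.2, Unit, inferInstance, fun _ => f i, fun _ => 1, fun _ => hf i, fun z _ => by
        simp [Algebra.algebraMap_eq_smul_one]⟩⟩
  have hσ : res hW' σ = ∑ i, F i * constSection W' (a i) := by
    ext y
    simp only [AddSubmonoidClass.coe_finsetSum, Finset.sum_apply]
    change σ.1 ⟨y.1, hW' y.2⟩ = ∑ i, algebraMap 𝕜 A₂ (f i ((y : U₂) : Fin m₂ → 𝕜)) * a i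
    rw [h ⟨y.1, hW' y.2⟩ y.2.2]
    simp only [Algebra.smul_def]
  have hres : ∀ a : A₂, (Φ.pullback W' (constSection W' a)).1 ⟨x.1, hx'⟩ = Φ.fiber x.1 a := by
    intro a
    exact congrFun (congrArg Subtype.val
      (Φ.pullback_res (W := ⊤) (W' := W') le_top (constSection ⊤ a))) ⟨x.1, hx'⟩
  have h1 : (Φ.pullback W σ).1 x = (Φ.pullback W' (res hW' σ)).1 ⟨x.1, hx'⟩ := by
    rw [Φ.pullback_res]
    rfl
  rw [h1, hσ, map_sum, h ⟨Φ.base x.1, x.2⟩ hx, map_sum, AddSubmonoidClass.coe_finsetSum,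
    Finset.sum_apply]
  refine Finset.sum_congr rfl fun i _ => ?_
  rw [map_mul, map_smul]
  change (Φ.pullback W' (F i)).1 ⟨x.1, hx'⟩ *
    (Φ.pullback W' (constSection W' (a i))).1 ⟨x.1, hx'⟩ = _
  rw [hres, Φ.pullback_function W' (F i) (fun y => f i ((y : U₂) : Fin m₂ → 𝕜)) (fun _ => rfl),
    Algebra.smul_def]

theorem RingedMor.ext_fiber {Φ Ψ : RingedMor U₁ A₁ U₂ A₂} (hb : Φ.base = Ψ.base)
    (h : ∀ x, Φ.fiber x = Ψ.fiber x) : Φ = Ψ := by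
  have key := Φ.pullback_apply
  have key' := Ψ.pullback_apply
  revert h key key'
  -- The types of the pull-backs depend on the base map. Abstracting the fibres first allows the
  -- base maps to be identified by `subst`.
  generalize Φ.fiber = p
  generalize Ψ.fiber = q
  intro h key key'
  obtain rfl : p = q := funext h
  cases Φ
  cases Ψ
  dsimp only at hb
  subst hb
  congr
  funext W
  ext σ x
  exact (key W σ x).trans (key' W σ x).symm

theorem RingedMor.PreservesWeights.fiber_mem {M : Type*} {Φ : RingedMor U₁ A₁ U₂ A₂}
    {c₁ : M → Submodule 𝕜 A₁} {c₂ : M → Submodule 𝕜 A₂} (hΦ : Φ.PreservesWeights c₁ c₂) {w : M}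
    {a : A₂} (ha : a ∈ c₂ w) (x : U₁) : Φ.fiber x a ∈ c₁ w :=
  hΦ w ⊤ (constSection ⊤ a) (fun _ => ha) ⟨x, trivial⟩

theorem RingedMor.fiber_comp {m₃ : ℕ} {U₃ : Opens (Fin m₃ → 𝕜)} {A₃ : Type*} [Semiring A₃]
    [Algebra 𝕜 A₃] (Ψ : RingedMor U₂ A₂ U₃ A₃) (Φ : RingedMor U₁ A₁ U₂ A₂) (x : U₁) :
    (Ψ.comp Φ).fiber x = (Φ.fiber x).comp (Ψ.fiber (Φ.base x)) := by
  ext a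
  exact Φ.pullback_apply _ (Ψ.pullback ⊤ (constSection ⊤ a)) ⟨x, trivial⟩

theorem RingedMor.fiber_ofAlgHom (q : A₂ →ₐ[𝕜] A₁) (x : U₁) :
    (RingedMor.ofAlgHom U₁ q).fiber x = q := rfl

/-- Sections are preserved by smooth base change together with a smooth family of homomorphisms of
algebras of constants. -/
theorem IsSection.comp_fiber {base : C(U₁, U₂)}
    (smooth_base : ∃ g : (Fin m₁ → 𝕜) → (Fin m₂ → 𝕜), ContDiffOn 𝕜 ∞ g U₁ ∧
      ∀ x : U₁, g x = base x) {θ : U₁ → A₂ →ₐ[𝕜] A₁}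
    (hθ : ∀ a, IsSection U₁ A₁ ⊤ fun x : (⊤ : Opens U₁) => θ x.1 a) {W : Opens U₂} {σ : W → A₂}
    (hσ : IsSection U₂ A₂ W σ) :
    IsSection U₁ A₁ (Opens.comap base W) fun x => θ x.1 (σ ⟨base x.1, x.2⟩) := by
  intro x
  obtain ⟨g, hg, hgb⟩ := smooth_base
  obtain ⟨N, hN, hx, ι, _, f, a, hf, h⟩ := hσ ⟨base x.1, x.2⟩
  -- The extension `g` of the base map is continuous only on `U₁`, hence the intersection.
  have hN' : IsOpen ((U₁ : Set (Fin m₁ → 𝕜)) ∩ g ⁻¹' N) :=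
    hg.continuousOn.isOpen_inter_preimage U₁.2 hN
  choose N' hN'o hxN' κ hκ e b he hb using fun i => hθ (a i) ⟨x.1, trivial⟩
  refine ⟨(U₁ ∩ g ⁻¹' N) ∩ ⋂ i, N' i, hN'.inter (isOpen_iInter_of_finite hN'o),
    ⟨⟨x.1.2, ?_⟩, Set.mem_iInter.2 hxN'⟩, Σ i, κ i, inferInstance,
    fun p y => f p.1 (g y) * e p.1 p.2 y, fun p => b p.1 p.2, ?_, ?_⟩
  · change g _ ∈ N
    rw [hgb]
    exact hx
  · rintro ⟨i, j⟩
    refine ContDiffOn.mul ?_ ((he i j).mono ?_)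
    · exact (hf i).comp (hg.mono fun z hz => hz.1.1) fun z hz => hz.1.2
    · exact fun z hz => Set.mem_iInter.1 hz.2 i
  · intro y hy
    have hy1 : ((base y.1 : U₂) : Fin m₂ → 𝕜) ∈ N := by
      rw [← hgb]
      exact hy.1.2
    refine (congrArg (θ y.1) (h ⟨base y.1, y.2⟩ hy1)).trans ?_
    rw [map_sum, Fintype.sum_sigma]
    refine Finset.sum_congr rfl fun i _ => ?_
    have := hb i ⟨y.1, trivial⟩ (Set.mem_iInter.1 hy.2 i)
    dsimp only at this
    rw [map_smul, this, Finset.smul_sum]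
    simp only [smul_smul, hgb]

/-- The morphism with a given base map that acts by `θ x` over the point `x`. -/
def RingedMor.ofFiber (base : C(U₁, U₂))
    (smooth_base : ∃ g : (Fin m₁ → 𝕜) → (Fin m₂ → 𝕜), ContDiffOn 𝕜 ∞ g U₁ ∧
      ∀ x : U₁, g x = base x) (θ : U₁ → A₂ →ₐ[𝕜] A₁)
    (hθ : ∀ a, IsSection U₁ A₁ ⊤ fun x : (⊤ : Opens U₁) => θ x.1 a) :
    RingedMor U₁ A₁ U₂ A₂ where
  base := base
  smooth_base := smooth_base
  pullback W :=
    { toFun := fun σ => ⟨fun x => θ x.1 (σ.1 ⟨base x.1, x.2⟩), σ.2.comp_fiber smooth_base hθ⟩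
      map_one' := Subtype.ext <| funext fun x => map_one (θ x.1)
      map_mul' := fun _ _ => Subtype.ext <| funext fun x => map_mul (θ x.1) _ _
      map_zero' := Subtype.ext <| funext fun x => map_zero (θ x.1)
      map_add' := fun _ _ => Subtype.ext <| funext fun x => map_add (θ x.1) _ _
      commutes' := fun c => Subtype.ext <| funext fun x => (θ x.1).commutes c }
  pullback_res _ _ := rfl
  pullback_function W σ f hf x := by
    change θ x.1 (σ.1 _) = _
    rw [hf, AlgHom.commutes]

/-- Linearity of `q` is enough; this matters because the left inverse of the covering pull-back, to
which it is applied, is only linear. -/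
theorem IsSection.map {m : ℕ} {U : Opens (Fin m → 𝕜)} {W : Opens U} {σ : W → A₁}
    (hσ : IsSection U A₁ W σ) (q : A₁ →ₗ[𝕜] A₂) : IsSection U A₂ W fun y => q (σ y) := by
  intro x
  obtain ⟨N, hN, hx, ι, i, f, a, hf, hs⟩ := hσ x
  refine ⟨N, hN, hx, ι, i, f, fun j => q (a j), hf, fun y hy => ?_⟩
  simp [hs y hy]

end Pointwise

/-! ### Homogeneous elements and twisting by characters of the weight monoid -/

section SuperAlgebra

open scoped TensorProduct

variable {𝕜 : Type*} [Field 𝕜] {G : Type*} {par : G → ZMod 2}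

theorem superSym_hom_ext {A : Type*} [Semiring A] [Algebra 𝕜 A] {f g : SuperSym 𝕜 par →ₐ[𝕜] A}
    (h : ∀ i, f (superGen par i) = g (superGen par i)) : f = g :=
  RingQuot.ringQuot_ext' _ _ _ (FreeAlgebra.hom_ext (funext h))

theorem superGen_mem_superComp {M : Type*} [AddCommMonoid M] (wt : G → M) (g : G) :
    (superGen par g : SuperSym 𝕜 par) ∈ superComp 𝕜 par wt (wt g) :=
  Submodule.subset_span ⟨[g], by simp, by simp⟩

theorem neg_one_pow_val_add (y z : ZMod 2) :
    (-1 : 𝕜) ^ (y + z).val = (-1 : 𝕜) ^ y.val * (-1 : 𝕜) ^ z.val := by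
  rw [ZMod.val_add, ← neg_one_pow_eq_pow_mod_two, pow_add]

/-- Homogeneous elements of the super-symmetric algebra commute up to the sign given by their
parities. -/
theorem superComp_swap {M : Type*} [AddCommMonoid M] {wt : G → M} {p : M →+ ZMod 2}
    (hp : ∀ g, par g = p (wt g)) {v w : M} {a b : SuperSym 𝕜 par}
    (ha : a ∈ superComp 𝕜 par wt v) (hb : b ∈ superComp 𝕜 par wt w) :
    a * b = ((-1 : 𝕜) ^ (p v * p w).val) • (b * a) := by
  -- The sign exponent is biadditive in the weights, so it suffices to move one generator past a
  -- monomial, and then a monomial past a monomial.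
  have step : ∀ (g : G) (l : List G), (superGen par g : SuperSym 𝕜 par) * (l.map (superGen par)).prod =
      ((-1 : 𝕜) ^ (p (wt g) * p (l.map wt).sum).val) •
        ((l.map (superGen par)).prod * superGen par g) := by
    intro g l
    induction l with
    | nil => simp
    | cons h l ih =>
      rw [List.map_cons, List.map_cons, List.prod_cons, List.sum_cons, ← mul_assoc, superGen_swap,
        smul_mul_assoc, mul_assoc, ih, map_add, mul_add, neg_one_pow_val_add, hp, hp,
        mul_smul_comm, smul_smul, mul_assoc]
  have step2 : ∀ l l' : List G, (l.map (superGen (𝕜 := 𝕜) par)).prod * (l'.map (superGen par)).prod =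
      ((-1 : 𝕜) ^ (p (l.map wt).sum * p (l'.map wt).sum).val) •
        ((l'.map (superGen par)).prod * (l.map (superGen par)).prod) := by
    intro l l'
    induction l with
    | nil => simp
    | cons h l ih =>
      rw [List.map_cons, List.map_cons, List.prod_cons, List.sum_cons, mul_assoc, ih, map_add,
        add_mul, neg_one_pow_val_add, mul_smul_comm, ← mul_assoc, step, smul_mul_assoc, smul_smul,
        mul_assoc, mul_comm ((-1 : 𝕜) ^ _)]
  refine Submodule.span_induction₂ (p := fun a b _ _ => a * b =
    ((-1 : 𝕜) ^ (p v * p w).val) • (b * a)) ?_ ?_ ?_ ?_ ?_ ?_ ?_ ha hb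
  · rintro _ _ ⟨l, rfl, rfl⟩ ⟨l', rfl, rfl⟩
    exact step2 l l'
  · simp
  · simp
  · intro x y z _ _ _ h h'
    rw [add_mul, mul_add, h, h', smul_add]
  · intro x y z _ _ _ h h'
    rw [add_mul, mul_add, h, h', smul_add]
  · intro c x y _ _ h
    rw [smul_mul_assoc, mul_smul_comm, h, smul_comm]
  · intro c x y _ _ h
    rw [smul_mul_assoc, mul_smul_comm, h, smul_comm]

theorem superLift_mem_superComp {G' : Type*} {par' : G' → ZMod 2} {M : Type*} [AddCommMonoid M]
    {wt : G → M} {wt' : G' → M} {v : G → SuperSym 𝕜 par'}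
    (hv : ∀ g h, v g * v h = ((-1 : 𝕜) ^ (par g * par h).val) • (v h * v g))
    (hw : ∀ g, v g ∈ superComp 𝕜 par' wt' (wt g)) {w : M} {a : SuperSym 𝕜 par}
    (ha : a ∈ superComp 𝕜 par wt w) : superLift v hv a ∈ superComp 𝕜 par' wt' w := by
  refine (Submodule.span_le
    (p := (superComp 𝕜 par' wt' w).comap (superLift v hv).toLinearMap)).2 ?_ ha
  rintro _ ⟨l, rfl, rfl⟩
  clear ha
  change superLift v hv _ ∈ superComp 𝕜 par' wt' _
  induction l with
  | nil => exact Submodule.subset_span ⟨[], by simp, by simp⟩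
  | cons g l ih =>
    rw [List.map_cons, List.map_cons, List.prod_cons, List.sum_cons, map_mul, superLift_gen]
    exact superComp_mul _ _ _ (Submodule.mul_mem_mul (hw g) ih)

variable {A R : Type*} [Semiring A] [Algebra 𝕜 A] [CommSemiring R] [Algebra 𝕜 R]

/-- The homomorphism `S^*(V) → A ⊗ R` which multiplies the values of a homomorphism `S^*(V) → A` on
generators by elements of the commutative algebra `R`. -/
def twist (v : G → A) (hv : ∀ g h, v g * v h = ((-1 : 𝕜) ^ (par g * par h).val) • (v h * v g))
    (x : G → R) : SuperSym 𝕜 par →ₐ[𝕜] A ⊗[𝕜] R :=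
  superLift (fun g => v g ⊗ₜ[𝕜] x g) fun g h => by
    rw [Algebra.TensorProduct.tmul_mul_tmul, Algebra.TensorProduct.tmul_mul_tmul, hv,
      mul_comm (x g), TensorProduct.smul_tmul']

/-- The scalars from `R` commute with everything, so a monomial collects the value of the character
`χ` at its total weight. This makes the weight visible in the second tensor factor. -/
theorem twist_of_mem {M : Type*} [AddCommMonoid M] {wt : G → M} (v : G → A)
    (hv : ∀ g h, v g * v h = ((-1 : 𝕜) ^ (par g * par h).val) • (v h * v g))
    {χ : M → R} (h0 : χ 0 = 1) (hadd : ∀ a b, χ (a + b) = χ a * χ b) {w : M} {a : SuperSym 𝕜 par}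
    (ha : a ∈ superComp 𝕜 par wt w) :
    twist v hv (fun g => χ (wt g)) a = superLift v hv a ⊗ₜ[𝕜] χ w := by
  refine LinearMap.eqOn_span (R := 𝕜) (f := (twist v hv fun g => χ (wt g)).toLinearMap)
    (g := ((TensorProduct.mk 𝕜 A R).flip (χ w)).comp (superLift v hv).toLinearMap) ?_ ha
  rintro _ ⟨l, rfl, rfl⟩
  clear ha
  change twist v hv _ _ = superLift v hv _ ⊗ₜ[𝕜] χ _
  induction l with
  | nil => simp [h0, Algebra.TensorProduct.one_def]
  | cons g l ih =>
    rw [List.map_cons, List.map_cons, List.prod_cons, List.sum_cons, map_mul, map_mul, ih, hadd,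
      superLift_gen, twist, superLift_gen, Algebra.TensorProduct.tmul_mul_tmul]

end SuperAlgebra

/-! ### Powers of sums of square-zero elements, and transitivity of permutations -/

section Combinatorics

/-- If all `x i` have square zero, then the `k`-th power of their sum is `k!` times the `k`-th
elementary symmetric polynomial. -/
theorem sum_pow_eq_factorial_mul_esymm {R ι : Type*} [CommSemiring R] [DecidableEq ι] (x : ι → R)
    (hx : ∀ i, x i * x i = 0) (s : Finset ι) (k : ℕ) :
    (∑ i ∈ s, x i) ^ k = (k.factorial : R) * ∑ t ∈ s.powersetCard k, ∏ i ∈ t, x i := by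
  -- Only the terms of degree at most one in `y` survive in the binomial expansion.
  have hpow : ∀ (y z : R), y * y = 0 → ∀ k : ℕ,
      (y + z) ^ (k + 1) = z ^ (k + 1) + (k + 1 : ℕ) * (y * z ^ k) := by
    intro y z hy k
    induction k with
    | zero => simp [add_comm]
    | succ k ih =>
      have : (z ^ (k + 1) + (k + 1 : ℕ) * (y * z ^ k)) * (y + z) =
          z ^ (k + 1 + 1) + (k + 1 + 1 : ℕ) * (y * z ^ (k + 1)) + (k + 1 : ℕ) * (z ^ k) * (y * y) := by
        push_cast
        ring
      rw [pow_succ, ih, this, hy, mul_zero, add_zero]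
  induction s using Finset.induction_on generalizing k with
  | empty =>
    cases k with
    | zero => simp
    | succ k =>
      rw [Finset.powersetCard_eq_empty.2 (by simp)]
      simp
  | insert a s ha ih =>
    cases k with
    | zero => simp
    | succ k =>
      have hdisj : Disjoint (s.powersetCard (k + 1)) ((s.powersetCard k).image (insert a)) := by
        rw [Finset.disjoint_left]
        intro t ht ht'
        obtain ⟨u, _, rfl⟩ := Finset.mem_image.1 ht'
        exact ha ((Finset.mem_powersetCard.1 ht).1 (Finset.mem_insert_self _ _))
      have hnot : ∀ t ∈ s.powersetCard k, a ∉ t := fun t ht hat =>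
        ha ((Finset.mem_powersetCard.1 ht).1 hat)
      rw [Finset.sum_insert ha, hpow _ _ (hx a), ih, ih, Finset.powersetCard_succ_insert ha,
        Finset.sum_union hdisj, Finset.sum_image, mul_add, Nat.factorial_succ]
      · congr 1
        rw [Finset.sum_congr rfl fun t ht => Finset.prod_insert (hnot t ht), ← Finset.mul_sum]
        push_cast
        ring
      · intro t ht t' ht' h
        rw [← Finset.erase_insert (hnot t ht), ← Finset.erase_insert (hnot t' ht'), h]

/-- The permutation group acts transitively on disjoint families of finite sets of given sizes. -/
theorem exists_perm_map_eq {α ι : Type*} [Fintype α] [DecidableEq α] {D D' : ι → Finset α}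
    (hD : ∀ i j, i ≠ j → Disjoint (D i) (D j)) (hD' : ∀ i j, i ≠ j → Disjoint (D' i) (D' j))
    (h : ∀ i, (D i).card = (D' i).card) :
    ∃ s : Equiv.Perm α, ∀ i, (D i).map s.toEmbedding = D' i := by
  classical
  have inj : ∀ {D : ι → Finset α}, (∀ i j, i ≠ j → Disjoint (D i) (D j)) →
      Function.Injective fun p : Σ i, D i => (p.2 : α) := by
    rintro D hD ⟨i, a, ha⟩ ⟨j, b, hb⟩ (rfl : a = b)
    obtain rfl : i = j := by
      by_contra hij
      exact Finset.disjoint_left.1 (hD i j hij) ha hb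
    rfl
  -- Bijections between the members are glued to a bijection between the unions, which disjointness
  -- identifies with the sigma types; it then extends to a permutation.
  let e : (Σ i, D i) ≃ Σ i, D' i :=
    Equiv.sigmaCongrRight fun i => Finset.equivOfCardEq (h i)
  let E := ((Equiv.ofInjective _ (inj hD)).symm.trans e).trans (Equiv.ofInjective _ (inj hD'))
  refine ⟨Equiv.extendSubtype E, fun i => Finset.eq_of_subset_of_card_le ?_ (by simp [h i])⟩
  intro b hb
  obtain ⟨a, ha, rfl⟩ := Finset.mem_map.1 hb
  have key : Equiv.extendSubtype E a = (e ⟨i, a, ha⟩).2 := by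
    rw [Equiv.extendSubtype_apply_of_mem E a ⟨⟨i, a, ha⟩, rfl⟩]
    have : (Equiv.ofInjective _ (inj hD)).symm ⟨a, ⟨⟨i, a, ha⟩, rfl⟩⟩ = ⟨i, a, ha⟩ :=
      Equiv.ofInjective_symm_apply (inj hD) ⟨i, a, ha⟩
    simp only [E, Equiv.trans_apply, this, Equiv.ofInjective_apply]
  change Equiv.extendSubtype E a ∈ D' i
  rw [key]
  exact (Finset.equivOfCardEq (h i) ⟨a, ha⟩).2

end Combinatorics

/-! ### The weight decomposition of the multiplicity-free algebra -/

section Coverings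

open scoped TensorProduct

variable {𝕜 : Type*} [RCLike 𝕜] {n : ℕ} {Δ : WeightSystem n} {ε : ZMod 2} {X : Shape 𝕜}

theorem algV_hom_ext {A : Type*} [Semiring A] [Algebra 𝕜 A] {f g : AlgV Δ ε X →ₐ[𝕜] A}
    (h : ∀ t, f (tGen Δ ε X t) = g (tGen Δ ε X t)) : f = g :=
  RingQuot.ringQuot_ext' _ _ _ (superSym_hom_ext h)

theorem toV_eq_zero {w : Fin n → ℕ} (hw : ¬ IsMultFreeWeight w) {a : AlgD Δ ε X}
    (ha : a ∈ compD Δ ε X w) : toV Δ ε X a = 0 :=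
  (RingQuot.mkAlgHom_rel 𝕜 (NonMultFreeRel.zero _ hw _ ha)).trans (map_zero _)

theorem tGen_mem_compV (t : TIndex Δ X) : tGen Δ ε X t ∈ compV Δ ε X (tWeight Δ X t) :=
  ⟨superGen _ t, superGen_mem_superComp _ t, rfl⟩

theorem tGen_swap (t u : TIndex Δ X) : tGen Δ ε X t * tGen Δ ε X u =
    ((-1 : 𝕜) ^ (tParity Δ ε X t * tParity Δ ε X u).val) • (tGen Δ ε X u * tGen Δ ε X t) := by
  have := congrArg (toV Δ ε X) (superGen_swap (𝕜 := 𝕜) (par := tParity Δ ε X) t u)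
  simp only [map_mul, map_smul] at this
  exact this

/-- The monomial of weight `w` in the polynomial ring. -/
def weightMonomial (𝕜 : Type*) [CommSemiring 𝕜] {n : ℕ} (w : Fin n → ℕ) :
    MvPolynomial (Fin n) 𝕜 :=
  MvPolynomial.monomial (Finsupp.equivFunOnFinite.symm w) 1

theorem weightMonomial_zero : weightMonomial 𝕜 (0 : Fin n → ℕ) = 1 := by
  have : Finsupp.equivFunOnFinite.symm (0 : Fin n → ℕ) = 0 := by ext; simp
  rw [weightMonomial, this]
  rfl

theorem weightMonomial_add (v w : Fin n → ℕ) :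
    weightMonomial 𝕜 (v + w) = weightMonomial 𝕜 v * weightMonomial 𝕜 w := by
  have : Finsupp.equivFunOnFinite.symm (v + w) =
      Finsupp.equivFunOnFinite.symm v + Finsupp.equivFunOnFinite.symm w := by ext; simp
  rw [weightMonomial, weightMonomial, weightMonomial, this, MvPolynomial.monomial_mul, one_mul]

/-- A twisted homomorphism descends to the multiplicity-free quotient. -/
def twistV {A R : Type*} [Semiring A] [Algebra 𝕜 A] [CommSemiring R] [Algebra 𝕜 R]
    (v : TIndex Δ X → A) (hv : ∀ t u, v t * v u =
      ((-1 : 𝕜) ^ (tParity Δ ε X t * tParity Δ ε X u).val) • (v u * v t))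
    (χ : (Fin n → ℕ) → R) (h0 : χ 0 = 1) (hadd : ∀ a b, χ (a + b) = χ a * χ b)
    (hvan : ∀ w, ¬ IsMultFreeWeight w → ∀ a ∈ compD Δ ε X w, superLift v hv a ⊗ₜ[𝕜] χ w = 0) :
    AlgV Δ ε X →ₐ[𝕜] A ⊗[𝕜] R :=
  RingQuot.liftAlgHom 𝕜 ⟨twist v hv fun t => χ (tWeight Δ X t), by
    rintro a _ ⟨w, hw, _, ha⟩
    rw [twist_of_mem v hv h0 hadd ha, hvan w hw a ha, map_zero]⟩

theorem twistV_toV {A R : Type*} [Semiring A] [Algebra 𝕜 A] [CommSemiring R] [Algebra 𝕜 R]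
    {v : TIndex Δ X → A} {hv : ∀ t u, v t * v u =
      ((-1 : 𝕜) ^ (tParity Δ ε X t * tParity Δ ε X u).val) • (v u * v t)}
    {χ : (Fin n → ℕ) → R} {h0 : χ 0 = 1} {hadd : ∀ a b, χ (a + b) = χ a * χ b}
    {hvan : ∀ w, ¬ IsMultFreeWeight w → ∀ a ∈ compD Δ ε X w, superLift v hv a ⊗ₜ[𝕜] χ w = 0}
    (a : AlgD Δ ε X) :
    twistV v hv χ h0 hadd hvan (toV Δ ε X a) = twist v hv (fun t => χ (tWeight Δ X t)) a := by
  simp [twistV, toV]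

/-- The coaction `a ↦ a ⊗ x^w` for `a` of weight `w`. -/
def coaction (Δ : WeightSystem n) (ε : ZMod 2) (X : Shape 𝕜) :
    AlgV Δ ε X →ₐ[𝕜] AlgV Δ ε X ⊗[𝕜] MvPolynomial (Fin n) 𝕜 :=
  twistV (tGen Δ ε X) tGen_swap (weightMonomial 𝕜) weightMonomial_zero weightMonomial_add
    fun w hw a ha => by
      have : superLift (tGen Δ ε X) tGen_swap = toV Δ ε X :=
        superSym_hom_ext fun t => superLift_gen _ _ t
      rw [this, toV_eq_zero hw ha, TensorProduct.zero_tmul]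

theorem coaction_of_mem {w : Fin n → ℕ} {a : AlgV Δ ε X} (ha : a ∈ compV Δ ε X w) :
    coaction Δ ε X a = a ⊗ₜ[𝕜] weightMonomial 𝕜 w := by
  obtain ⟨b, hb, rfl⟩ := ha
  have : superLift (tGen Δ ε X) tGen_swap = toV Δ ε X :=
    superSym_hom_ext fun t => superLift_gen _ _ t
  change coaction Δ ε X (toV Δ ε X b) = toV Δ ε X b ⊗ₜ[𝕜] weightMonomial 𝕜 w
  rw [coaction, twistV_toV, twist_of_mem _ _ weightMonomial_zero weightMonomial_add hb, this]

/-- The projection to the component of weight `w`. -/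
def weightProj (Δ : WeightSystem n) (ε : ZMod 2) (X : Shape 𝕜) (w : Fin n → ℕ) :
    AlgV Δ ε X →ₗ[𝕜] AlgV Δ ε X :=
  (TensorProduct.rid 𝕜 (AlgV Δ ε X)).toLinearMap ∘ₗ
    (MvPolynomial.lcoeff 𝕜 (Finsupp.equivFunOnFinite.symm w)).lTensor (AlgV Δ ε X) ∘ₗ
      (coaction Δ ε X).toLinearMap

/-- The coaction tags `a` with `x^v`, and the projection reads off the coefficient of `x^w`. Hence
the weight components are independent, although the algebra is given by generators and relations. -/
theorem weightProj_of_mem {v : Fin n → ℕ} {a : AlgV Δ ε X} (ha : a ∈ compV Δ ε X v)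
    (w : Fin n → ℕ) : weightProj Δ ε X w a = if v = w then a else 0 := by
  simp [weightProj, coaction_of_mem ha, weightMonomial, MvPolynomial.coeff_monomial]

/-- Families of elements of distinct weights are determined by their sums. -/
theorem eq_of_sum_eq_of_mem_compV {ι : Type*} [Fintype ι] {w : ι → Fin n → ℕ}
    (hw : Function.Injective w) {a b : ι → AlgV Δ ε X} (ha : ∀ i, a i ∈ compV Δ ε X (w i))
    (hb : ∀ i, b i ∈ compV Δ ε X (w i)) (h : ∑ i, a i = ∑ i, b i) (i : ι) : a i = b i := by
  classical
  have := congrArg (weightProj Δ ε X (w i)) h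
  simpa [map_sum, weightProj_of_mem (ha _), weightProj_of_mem (hb _), hw.eq_iff] using this

/-! ### Injectivity of the covering projection in low weights -/

/-- The ideal generated by the squares of the variables. -/
def squareIdeal (𝕜 : Type*) [CommRing 𝕜] (n : ℕ) : Ideal (MvPolynomial (Fin n) 𝕜) :=
  Ideal.span ((fun s => MvPolynomial.monomial s (1 : 𝕜)) ''
    Set.range fun i : Fin n => Finsupp.single i 2)

/-- The polynomial ring modulo the squares of the variables. -/
def SquareFree (𝕜 : Type*) [CommRing 𝕜] (n : ℕ) : Type _ :=
  MvPolynomial (Fin n) 𝕜 ⧸ squareIdeal 𝕜 n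

instance (𝕜 : Type*) [CommRing 𝕜] (n : ℕ) : CommRing (SquareFree 𝕜 n) :=
  inferInstanceAs (CommRing (MvPolynomial (Fin n) 𝕜 ⧸ squareIdeal 𝕜 n))

instance (𝕜 : Type*) [CommRing 𝕜] (n : ℕ) : Algebra 𝕜 (SquareFree 𝕜 n) :=
  inferInstanceAs (Algebra 𝕜 (MvPolynomial (Fin n) 𝕜 ⧸ squareIdeal 𝕜 n))

/-- The quotient map. -/
def toSquareFree (𝕜 : Type*) [CommRing 𝕜] (n : ℕ) : MvPolynomial (Fin n) 𝕜 →+* SquareFree 𝕜 n :=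
  Ideal.Quotient.mk (squareIdeal 𝕜 n)

/-- The monomial of weight `w` modulo the squares of the variables. -/
def squareFreeMonomial (𝕜 : Type*) [CommRing 𝕜] {n : ℕ} (w : Fin n → ℕ) : SquareFree 𝕜 n :=
  toSquareFree 𝕜 n (weightMonomial 𝕜 w)

theorem squareFreeMonomial_zero : squareFreeMonomial 𝕜 (0 : Fin n → ℕ) = 1 := by
  rw [squareFreeMonomial, weightMonomial_zero, map_one]

theorem squareFreeMonomial_add (v w : Fin n → ℕ) : squareFreeMonomial 𝕜 (v + w) =
    squareFreeMonomial 𝕜 v * squareFreeMonomial 𝕜 w := by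
  rw [squareFreeMonomial, weightMonomial_add, map_mul]
  rfl

/-- A monomial lies in a monomial ideal exactly when one of the generators, here some `x_i²`,
divides it. -/
theorem squareFreeMonomial_eq_zero_iff (w : Fin n → ℕ) :
    squareFreeMonomial 𝕜 w = 0 ↔ ¬ IsMultFreeWeight w := by
  have h : squareFreeMonomial 𝕜 w = 0 ↔ weightMonomial 𝕜 w ∈ squareIdeal 𝕜 n :=
    Ideal.Quotient.eq_zero_iff_mem
  rw [h, squareIdeal, MvPolynomial.mem_ideal_span_monomial_image, weightMonomial,
    MvPolynomial.support_monomial, if_neg one_ne_zero]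
  simp only [Finset.mem_singleton, forall_eq, Set.exists_range_iff, Finsupp.single_le_iff,
    IsMultFreeWeight, not_forall, not_le]
  rfl

theorem squareFreeMonomial_indicator (δ : Finset (Fin n)) :
    squareFreeMonomial 𝕜 (fun i => if i ∈ δ then 1 else 0) =
      ∏ i ∈ δ, squareFreeMonomial 𝕜 (Pi.single i 1) := by
  induction δ using Finset.induction_on with
  | empty => exact squareFreeMonomial_zero
  | insert a s ha ih =>
    rw [Finset.prod_insert ha, ← ih, ← squareFreeMonomial_add]
    congr 1
    funext i
    by_cases h : i = a
    · subst h
      simp [ha]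
    · simp [h]

/-- The sum of the variables. -/
def squareFreeSum (𝕜 : Type*) [CommRing 𝕜] (n : ℕ) : SquareFree 𝕜 n :=
  ∑ i, squareFreeMonomial 𝕜 (Pi.single i 1)

theorem squareFreeSum_pow (k : ℕ) : squareFreeSum 𝕜 n ^ k =
    (k.factorial : 𝕜) • ∑ δ ∈ Finset.univ.powersetCard k,
      squareFreeMonomial 𝕜 (fun i : Fin n => if i ∈ δ then 1 else 0) := by
  rw [squareFreeSum, sum_pow_eq_factorial_mul_esymm, Algebra.smul_def, map_natCast]
  · simp only [squareFreeMonomial_indicator]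
  · intro i
    rw [← squareFreeMonomial_add, squareFreeMonomial_eq_zero_iff]
    intro h
    simpa using h i

/-- Otherwise the `n`-th power, which is `n! x₁ ⋯ x_n`, would vanish too. -/
theorem squareFreeSum_pow_ne_zero {k : ℕ} (hk : k ≤ n) : squareFreeSum 𝕜 n ^ k ≠ 0 := by
  intro h
  have : squareFreeSum 𝕜 n ^ n = 0 := by
    rw [← pow_mul_pow_sub _ hk, h, zero_mul]
  rw [squareFreeSum_pow] at this
  have hn : (Finset.univ : Finset (Fin n)).powersetCard n = {Finset.univ} := by
    simpa using Finset.powersetCard_self (Finset.univ : Finset (Fin n))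
  rw [hn, Finset.sum_singleton, smul_eq_zero, squareFreeMonomial_eq_zero_iff] at this
  rcases this with h | h
  · exact Nat.factorial_ne_zero n (by exact_mod_cast h)
  · exact h fun i => by simp

/-- Permutations act transitively on subsets of a given size, so `Δ` contains all subsets of a size
or none. -/
theorem WeightSystem.mem_weights_of_card_mem {Δ : WeightSystem n} {δ : Finset (Fin n)}
    (h : δ.card ∈ Δ.lengths) : δ ∈ Δ.weights := by
  obtain ⟨δ', hδ', hc⟩ := h
  obtain ⟨s, hs⟩ := exists_perm_map_eq (ι := Unit) (D := fun _ => δ') (D' := fun _ => δ)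
    (fun i j h => (h rfl).elim) (fun i j h => (h rfl).elim) fun _ => hc
  rw [← hs ()]
  exact Δ.invariant s _ hδ'

theorem xiParity_swap (v : XiIndex Δ X → 𝕜) (g h : XiIndex Δ X) :
    (v g • superGen (xiParity Δ ε X) g : AlgU Δ ε X) * (v h • superGen (xiParity Δ ε X) h) =
      ((-1 : 𝕜) ^ (xiParity Δ ε X g * xiParity Δ ε X h).val) •
        ((v h • superGen (xiParity Δ ε X) h) * (v g • superGen (xiParity Δ ε X) g)) := by
  rw [smul_mul_smul_comm, smul_mul_smul_comm, superGen_swap, smul_comm, mul_comm (v g)]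

theorem tParity_eq (t : TIndex Δ X) : tParity Δ ε X t = xiParity Δ ε X t.1 := by
  rw [tParity, xiParity, t.2.2.2]

/-- The homomorphism `t_j^δ ↦ ξ_j^{♯δ} ⊗ x^δ`. -/
def uncover (Δ : WeightSystem n) (ε : ZMod 2) (X : Shape 𝕜) :
    AlgV Δ ε X →ₐ[𝕜] AlgU Δ ε X ⊗[𝕜] SquareFree 𝕜 n :=
  twistV (fun t => superGen _ t.1)
    (fun t u => by rw [tParity_eq, tParity_eq]; exact superGen_swap _ _)
    (squareFreeMonomial 𝕜) squareFreeMonomial_zero squareFreeMonomial_add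
    fun w hw a ha => by
      -- Here the second tensor factor vanishes; in `coaction` it was the first.
      rw [(squareFreeMonomial_eq_zero_iff w).2 hw, TensorProduct.tmul_zero]

theorem uncover_tGen (t : TIndex Δ X) : uncover Δ ε X (tGen Δ ε X t) =
    superGen _ t.1 ⊗ₜ[𝕜] squareFreeMonomial 𝕜 (tWeight Δ X t) := by
  rw [uncover, tGen, twistV_toV, twist, superLift_gen]

/-- All subsets of size `k` occur in the sum, so the second factor is the elementary symmetric
polynomial `e_k = e^k / k!`. In contrast to `e_k`, the power `e^k` is multiplicative in `k`, so the
composite with the covering is again a twist by a character. -/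
theorem uncover_coverVal (g : XiIndex Δ X) : uncover Δ ε X (coverVal Δ ε X g) =
    (((g.1 : ℕ).factorial : 𝕜)⁻¹ • superGen _ g) ⊗ₜ[𝕜] (squareFreeSum 𝕜 n ^ (g.1 : ℕ)) := by
  have hf : ((g.1 : ℕ).factorial : 𝕜) ≠ 0 := by exact_mod_cast Nat.factorial_ne_zero _
  rw [squareFreeSum_pow, TensorProduct.tmul_smul, ← TensorProduct.smul_tmul', smul_smul,
    mul_inv_cancel₀ hf, one_smul, coverVal, map_sum, TensorProduct.tmul_sum]
  simp only [uncover_tGen]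
  refine Finset.sum_bij (fun δ _ => δ.1) ?_ ?_ ?_ ?_
  · intro δ _
    simp [Finset.mem_powersetCard, δ.2.2]
  · intro δ _ δ' _ h
    exact Subtype.ext h
  · intro δ hδ
    have hc := (Finset.mem_powersetCard.1 hδ).2
    exact ⟨⟨δ, WeightSystem.mem_weights_of_card_mem (hc ▸ g.1.2.1), hc⟩, Finset.mem_univ _, rfl⟩
  · intro δ _
    rfl

/-- The covering projection is injective on weights up to `n`. -/
theorem coverAlg_injOn {k : ℕ} (hk : k ≤ n) {u : AlgU Δ ε X} (hu : u ∈ compU Δ ε X k)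
    (h : coverAlg Δ ε X u = 0) : u = 0 := by
  let c : XiIndex Δ X → 𝕜 := fun g => ((g.1 : ℕ).factorial : 𝕜)
  -- `S` rescales each generator of weight `k` by `1/k!` and `T` undoes this, so `S` is injective.
  let S := superLift (fun g => (c g)⁻¹ • superGen (xiParity Δ ε X) g)
    (xiParity_swap fun g => (c g)⁻¹)
  let T := superLift (fun g => c g • superGen (xiParity Δ ε X) g) (xiParity_swap c)
  have hTS : T.comp S = AlgHom.id 𝕜 _ := by
    refine superSym_hom_ext fun g => ?_
    have hf : c g ≠ 0 := Nat.cast_ne_zero.2 (Nat.factorial_ne_zero _)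
    simp [S, T, smul_smul, inv_mul_cancel₀ hf]
  have h1 : (uncover Δ ε X).comp (coverAlg Δ ε X) =
      twist (fun g => (c g)⁻¹ • superGen (xiParity Δ ε X) g) (xiParity_swap fun g => (c g)⁻¹)
        (fun g => squareFreeSum 𝕜 n ^ xiWeight Δ X g) := by
    refine superSym_hom_ext fun g => ?_
    rw [AlgHom.comp_apply, coverAlg_gen, uncover_coverVal, twist, superLift_gen]
    rfl
  have h2 : S u ⊗ₜ[𝕜] (squareFreeSum 𝕜 n ^ k) = 0 := by
    rw [← twist_of_mem (χ := fun k => squareFreeSum 𝕜 n ^ k) _ _ (pow_zero _) (pow_add _) hu, ← h1,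
      AlgHom.comp_apply, h, map_zero]
  -- A functional with value `1` on `e^k` removes the second tensor factor.
  obtain ⟨f, hf⟩ := Module.Projective.exists_dual_eq_one 𝕜
    (squareFreeSum_pow_ne_zero (𝕜 := 𝕜) hk)
  have h3 := congrArg (fun z => TensorProduct.rid 𝕜 (AlgU Δ ε X) (f.lTensor (AlgU Δ ε X) z)) h2
  simp only [LinearMap.lTensor_tmul, hf, TensorProduct.rid_tmul, one_smul, map_zero] at h3
  have := DFunLike.congr_fun hTS u
  rw [AlgHom.comp_apply, h3, map_zero] at this
  exact this.symm

end Coverings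

/-! ### Invariants of the permutation group come from the base of the covering -/

section Invariants

variable {𝕜 : Type*} [RCLike 𝕜] {n : ℕ} {Δ : WeightSystem n} {ε : ZMod 2} {X : Shape 𝕜}

theorem permV_coverVal (s : Equiv.Perm (Fin n)) (g : XiIndex Δ X) :
    permV ε s (coverVal Δ ε X g) = coverVal Δ ε X g := by
  rw [coverVal, map_sum]
  simp only [permV_tGen]
  let e : {δ : Finset (Fin n) // δ ∈ Δ.weights ∧ δ.card = g.1} →
      {δ : Finset (Fin n) // δ ∈ Δ.weights ∧ δ.card = g.1} :=
    fun δ => (permIndex (X := X) s ⟨g, δ⟩).2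
  have he : Function.Injective e := fun δ δ' h =>
    Subtype.ext (Finset.map_injective _ (congrArg Subtype.val h))
  exact (Finite.injective_iff_bijective.1 he).sum_comp fun δ => tGen Δ ε X ⟨g, δ⟩

theorem permV_coverAlg (s : Equiv.Perm (Fin n)) (u : AlgU Δ ε X) :
    permV ε s (coverAlg Δ ε X u) = coverAlg Δ ε X u := by
  have : (permV ε s).comp (coverAlg Δ ε X) = coverAlg Δ ε X :=
    superSym_hom_ext fun g => by simp [permV_coverVal]
  exact DFunLike.congr_fun this u

theorem permV_mul (s s' : Equiv.Perm (Fin n)) (v : AlgV Δ ε X) :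
    permV ε (s * s') v = permV ε s (permV ε s' v) := by
  have : permV (Δ := Δ) (X := X) ε (s * s') = (permV ε s).comp (permV ε s') := by
    refine algV_hom_ext fun t => ?_
    simp only [AlgHom.comp_apply, permV_tGen]
    congr 1
    simp only [permIndex, Finset.map_map]
    rfl
  exact DFunLike.congr_fun this v

/-- The sum over the orbit of the permutation group, as a linear map. -/
def orbitSum (Δ : WeightSystem n) (ε : ZMod 2) (X : Shape 𝕜) : AlgV Δ ε X →ₗ[𝕜] AlgV Δ ε X :=
  ∑ s, (permV ε s).toLinearMap

theorem orbitSum_apply (v : AlgV Δ ε X) : orbitSum Δ ε X v = ∑ s, permV ε s v := by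
  simp [orbitSum]

theorem orbitSum_permV (s : Equiv.Perm (Fin n)) (v : AlgV Δ ε X) :
    orbitSum Δ ε X (permV ε s v) = orbitSum Δ ε X v := by
  simp only [orbitSum_apply, ← permV_mul]
  exact (Group.mulRight_bijective s).sum_comp fun s' => permV ε s' v

theorem orbitSum_of_invariant {v : AlgV Δ ε X} (hv : ∀ s, permV ε s v = v) :
    orbitSum Δ ε X v = (n.factorial : 𝕜) • v := by
  rw [orbitSum_apply, Finset.sum_congr rfl fun s _ => hv s, Finset.sum_const, Finset.card_univ,
    Fintype.card_perm, Fintype.card_fin, Nat.cast_smul_eq_nsmul]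

/-- The monomial `t_{j₁}^{δ₁} ⋯ t_{j_r}^{δ_r}`. -/
def tMonomial {r : ℕ} (Δ : WeightSystem n) (ε : ZMod 2) (X : Shape 𝕜) (t : Fin r → TIndex Δ X) :
    AlgV Δ ε X :=
  (List.ofFn fun i => tGen Δ ε X (t i)).prod

theorem permV_tMonomial {r : ℕ} (s : Equiv.Perm (Fin n)) (t : Fin r → TIndex Δ X) :
    permV ε s (tMonomial Δ ε X t) = tMonomial Δ ε X fun i => permIndex s (t i) := by
  rw [tMonomial, map_list_prod, List.map_ofFn, tMonomial]
  congr 2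
  funext i
  exact permV_tGen _ _ _

theorem tMonomial_eq_toV {r : ℕ} (t : Fin r → TIndex Δ X) : tMonomial Δ ε X t =
    toV Δ ε X ((List.ofFn t).map (superGen (tParity Δ ε X))).prod := by
  rw [map_list_prod, List.map_map, List.map_ofFn]
  rfl

theorem tMonomial_eq_zero {r : ℕ} {t : Fin r → TIndex Δ X}
    (ht : ¬ IsMultFreeWeight (∑ i, tWeight Δ X (t i))) : tMonomial Δ ε X t = 0 := by
  rw [tMonomial_eq_toV]
  refine toV_eq_zero ht (Submodule.subset_span ⟨List.ofFn t, ?_, rfl⟩)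
  rw [List.map_ofFn, List.sum_ofFn]
  rfl

/-- The product of sums is expanded by multilinearity of the ordered product, so the factors keep
their order and no signs appear. -/
theorem coverAlg_monomial {r : ℕ} (g : Fin r → XiIndex Δ X) :
    coverAlg Δ ε X ((List.ofFn g).map (superGen (xiParity Δ ε X))).prod =
      ∑ τ : ∀ i, {δ : Finset (Fin n) // δ ∈ Δ.weights ∧ δ.card = (g i).1},
        tMonomial Δ ε X fun i => ⟨g i, τ i⟩ := by
  have := (MultilinearMap.mkPiAlgebraFin 𝕜 r (AlgV Δ ε X)).map_sum
    (fun i (δ : {δ : Finset (Fin n) // δ ∈ Δ.weights ∧ δ.card = (g i).1}) =>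
      tGen Δ ε X ⟨g i, δ⟩)
  simp only [MultilinearMap.mkPiAlgebraFin_apply] at this
  rw [map_list_prod, List.map_map, List.map_ofFn]
  refine Eq.trans ?_ this
  congr 2
  funext i
  exact coverAlg_gen _ _ _ _

theorem disjoint_of_isMultFreeWeight {r : ℕ} {t : Fin r → TIndex Δ X}
    (ht : IsMultFreeWeight (∑ i, tWeight Δ X (t i))) {i j : Fin r} (hij : i ≠ j) :
    Disjoint (t i).2.1 (t j).2.1 := by
  rw [Finset.disjoint_left]
  intro a hi hj
  have h1 : ∑ l ∈ {i, j}, tWeight Δ X (t l) a ≤ ∑ l, tWeight Δ X (t l) a :=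
    Finset.sum_le_sum_of_subset (Finset.subset_univ _)
  have h2 := ht a
  rw [Finset.sum_pair hij, tWeight, tWeight, if_pos hi, if_pos hj] at h1
  rw [Finset.sum_apply] at h2
  omega

/-- Multiplicity-freeness makes both families of subsets disjoint, with equal sizes position by
position, so one permutation carries the first to the second. -/
theorem exists_permIndex_eq {r : ℕ} {g : Fin r → XiIndex Δ X}
    {τ τ' : ∀ i, {δ : Finset (Fin n) // δ ∈ Δ.weights ∧ δ.card = (g i).1}}
    (h : IsMultFreeWeight (∑ i, tWeight Δ X ⟨g i, τ i⟩))
    (h' : IsMultFreeWeight (∑ i, tWeight Δ X ⟨g i, τ' i⟩)) :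
    ∃ s, ∀ i, permIndex s (⟨g i, τ i⟩ : TIndex Δ X) = ⟨g i, τ' i⟩ := by
  obtain ⟨s, hs⟩ := exists_perm_map_eq (D := fun i => (τ i).1) (D' := fun i => (τ' i).1)
    (fun i j hij => disjoint_of_isMultFreeWeight h hij)
    (fun i j hij => disjoint_of_isMultFreeWeight h' hij)
    fun i => (τ i).2.2.trans (τ' i).2.2.symm
  refine ⟨s, fun i => ?_⟩
  have : (⟨(τ i).1.map s.toEmbedding, Δ.invariant s _ (τ i).2.1, by
      rw [Finset.card_map]; exact (τ i).2.2⟩ :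
      {δ : Finset (Fin n) // δ ∈ Δ.weights ∧ δ.card = (g i).1}) = τ' i := Subtype.ext (hs i)
  rw [← this]
  rfl

/-- Orbit sums of monomials come from the base of the covering. -/
theorem orbitSum_tMonomial {r : ℕ} (g : Fin r → XiIndex Δ X)
    (τ : ∀ i, {δ : Finset (Fin n) // δ ∈ Δ.weights ∧ δ.card = (g i).1}) :
    ∃ c : 𝕜, orbitSum Δ ε X (tMonomial Δ ε X fun i => ⟨g i, τ i⟩) =
      c • coverAlg Δ ε X ((List.ofFn g).map (superGen (xiParity Δ ε X))).prod := by
  classical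
  by_cases h : IsMultFreeWeight (∑ i, tWeight Δ X ⟨g i, τ i⟩)
  swap
  · exact ⟨0, by rw [tMonomial_eq_zero h, map_zero, zero_smul]⟩
  -- `T` collects the terms of the expanded pull-back whose weight is multiplicity-free. It contains
  -- `τ`, so its cardinality is invertible.
  let T : Finset (∀ i, {δ : Finset (Fin n) // δ ∈ Δ.weights ∧ δ.card = (g i).1}) :=
    Finset.univ.filter fun τ' => IsMultFreeWeight (∑ i, tWeight Δ X ⟨g i, τ' i⟩)
  have hT : (T.card : 𝕜) ≠ 0 :=
    Nat.cast_ne_zero.2 (Finset.card_ne_zero_of_mem (a := τ) (by simpa [T] using h))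
  have hsum : coverAlg Δ ε X ((List.ofFn g).map (superGen (xiParity Δ ε X))).prod =
      ∑ τ' ∈ T, tMonomial Δ ε X fun i => ⟨g i, τ' i⟩ := by
    rw [coverAlg_monomial]
    refine (Finset.sum_subset (Finset.subset_univ _) fun τ' _ hτ' => ?_).symm
    exact tMonomial_eq_zero (by simpa [T] using hτ')
  have hconst : ∀ τ' ∈ T, orbitSum Δ ε X (tMonomial Δ ε X fun i => ⟨g i, τ' i⟩) =
      orbitSum Δ ε X (tMonomial Δ ε X fun i => ⟨g i, τ i⟩) := by
    intro τ' hτ'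
    obtain ⟨s, hs⟩ := exists_permIndex_eq h (Finset.mem_filter.1 hτ').2
    rw [← orbitSum_permV s (tMonomial Δ ε X fun i => ⟨g i, τ i⟩), permV_tMonomial]
    simp only [hs]
  -- The pull-back is invariant, so its orbit sum is `n!` times itself; on the other side stand
  -- `T.card` equal orbit sums. This gives the constant `n! / T.card`.
  have key := congrArg (orbitSum Δ ε X) hsum
  rw [orbitSum_of_invariant fun s => permV_coverAlg s _, map_sum, Finset.sum_congr rfl hconst,
    Finset.sum_const, ← Nat.cast_smul_eq_nsmul 𝕜] at key
  refine ⟨(T.card : 𝕜)⁻¹ * n.factorial, ?_⟩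
  rw [mul_smul, key, smul_smul, inv_mul_cancel₀ hT, one_smul]

/-- It suffices to treat monomials, which span. The total length of a monomial in the `t_j^δ` is the
weight of the monomial in the `ξ_j^k` underneath, so the preimage has weight `k`. -/
theorem orbitSum_mem {k : ℕ} {v : AlgV Δ ε X} (hv : v ∈ lengthCompV Δ ε X k) :
    orbitSum Δ ε X v ∈ (compU Δ ε X k).map (coverAlg Δ ε X).toLinearMap := by
  suffices h : lengthCompV Δ ε X k ≤
      ((compU Δ ε X k).map (coverAlg Δ ε X).toLinearMap).comap (orbitSum Δ ε X) from h hv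
  refine iSup₂_le fun w hw => ?_
  rw [compV, Submodule.map_le_iff_le_comap]
  refine Submodule.span_le.2 ?_
  rintro _ ⟨l, rfl, rfl⟩
  have hl : toV Δ ε X (l.map (superGen (tParity Δ ε X))).prod =
      tMonomial Δ ε X fun i : Fin l.length => ⟨(l.get i).1, (l.get i).2⟩ := by
    rw [tMonomial_eq_toV]
    congr 3
    exact (List.ofFn_get l).symm
  change orbitSum Δ ε X (toV Δ ε X _) ∈ (compU Δ ε X k).map (coverAlg Δ ε X).toLinearMap
  rw [hl]
  obtain ⟨c, hc⟩ := orbitSum_tMonomial (ε := ε) (fun i => (l.get i).1) fun i => (l.get i).2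
  rw [hc]
  refine Submodule.smul_mem _ _ ⟨_, Submodule.subset_span ⟨_, ?_, rfl⟩, rfl⟩
  rw [← hw, List.map_ofFn, List.sum_ofFn]
  have hlen : ∀ l : List (TIndex Δ X), ∑ i, (l.map (tWeight Δ X)).sum i =
      (l.map fun t => (t.1.1 : ℕ)).sum := by
    intro l
    induction l with
    | nil => simp
    | cons t l ih =>
      simp only [List.map_cons, List.sum_cons, Pi.add_apply, Finset.sum_add_distrib, ih]
      simp [tWeight, t.2.2.2]
  change _ = ∑ i, (l.map (tWeight Δ X)).sum i
  rw [hlen, ← List.sum_ofFn]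
  congr 1
  conv_rhs => rw [← List.ofFn_get l, List.map_ofFn]
  rfl

/-- Invariant elements of length `k` come from elements of weight `k` of the base. -/
theorem exists_coverAlg_eq_of_invariant {k : ℕ} {v : AlgV Δ ε X}
    (hv : v ∈ lengthCompV Δ ε X k) (hinv : ∀ s, permV ε s v = v) :
    ∃ u ∈ compU Δ ε X k, coverAlg Δ ε X u = v := by
  obtain ⟨u, hu, h⟩ := orbitSum_mem hv
  have hn : (n.factorial : 𝕜) ≠ 0 := Nat.cast_ne_zero.2 (Nat.factorial_ne_zero n)
  refine ⟨(n.factorial : 𝕜)⁻¹ • u, Submodule.smul_mem _ _ hu, ?_⟩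
  rw [orbitSum_of_invariant hinv] at h
  change coverAlg Δ ε X u = _ at h
  rw [map_smul, h, smul_smul, inv_mul_cancel₀ hn, one_smul]

theorem XiIndex.le {g : XiIndex Δ X} : (g.1 : ℕ) ≤ n := by
  obtain ⟨δ, _, h⟩ := g.1.2.1
  rw [← h]
  exact card_finset_fin_le δ

/-- A linear map which recovers elements of weight `k ≤ n` from their pull-back to the covering. -/
theorem exists_coverAlg_leftInverse (Δ : WeightSystem n) (ε : ZMod 2) (X : Shape 𝕜) {k : ℕ}
    (hk : k ≤ n) : ∃ R : AlgV Δ ε X →ₗ[𝕜] AlgU Δ ε X, (∀ v, R v ∈ compU Δ ε X k) ∧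
      ∀ u ∈ compU Δ ε X k, R (coverAlg Δ ε X u) = u := by
  let ι : compU Δ ε X k →ₗ[𝕜] AlgV Δ ε X :=
    (coverAlg Δ ε X).toLinearMap ∘ₗ (compU Δ ε X k).subtype
  have hι : ι.ker = ⊥ :=
    LinearMap.ker_eq_bot'.2 fun u hu => Subtype.ext (coverAlg_injOn hk u.2 hu)
  let _ : AddCommGroup (AlgV Δ ε X) := Module.addCommMonoidToAddCommGroup 𝕜
  let _ : AddCommGroup (compU Δ ε X k) := Module.addCommMonoidToAddCommGroup 𝕜
  obtain ⟨R, hR⟩ := ι.exists_leftInverse_of_injective hι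
  exact ⟨(compU Δ ε X k).subtype ∘ₗ R, fun v => (R v).2, fun u hu =>
    congrArg Subtype.val (LinearMap.congr_fun hR ⟨u, hu⟩)⟩

end Invariants

/-! ### Uniqueness of lifts and descent of invariant morphisms -/

section Descent

variable {𝕜 : Type*} [RCLike 𝕜] {n : ℕ} {Δ : WeightSystem n} {ε : ZMod 2} {X Y : Shape 𝕜}

/-- Both composites are determined by the base map and, over each point, by the images of the
generators `ξ_j^k`. -/
theorem cover_comp_eq_iff {φ : GradedMor Δ ε X Y} {Φ : MultFreeMor Δ ε X Y} :
    (cover Δ ε Y).comp Φ.1 = φ.1.comp (cover Δ ε X) ↔ Φ.1.base = φ.1.base ∧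
      ∀ x g, coverAlg Δ ε X (φ.1.fiber x (superGen _ g)) = Φ.1.fiber x (coverVal Δ ε Y g) := by
  constructor
  · intro h
    refine ⟨congrArg RingedMor.base h, fun x g => ?_⟩
    have := DFunLike.congr_fun (congrArg (fun Ψ => Ψ.fiber x) h) (superGen _ g)
    simp only [RingedMor.fiber_comp, cover, RingedMor.fiber_ofAlgHom, AlgHom.comp_apply,
      coverAlg_gen] at this
    exact this.symm
  · rintro ⟨hb, h⟩
    refine RingedMor.ext_fiber hb fun x => superSym_hom_ext fun g => ?_
    simp only [RingedMor.fiber_comp, cover, RingedMor.fiber_ofAlgHom, AlgHom.comp_apply,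
      coverAlg_gen]
    exact (h x g).symm

/-- The multiplicity-free lift is unique. -/
theorem MultFreeMor.eq_of_cover_comp_eq {φ : GradedMor Δ ε X Y} {Φ Φ' : MultFreeMor Δ ε X Y}
    (h : (cover Δ ε Y).comp Φ.1 = φ.1.comp (cover Δ ε X))
    (h' : (cover Δ ε Y).comp Φ'.1 = φ.1.comp (cover Δ ε X)) : Φ' = Φ := by
  obtain ⟨hb, hf⟩ := cover_comp_eq_iff.1 h
  obtain ⟨hb', hf'⟩ := cover_comp_eq_iff.1 h'
  refine Subtype.ext (RingedMor.ext_fiber (hb'.trans hb.symm) fun x => algV_hom_ext ?_)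
  rintro ⟨g, δ⟩
  have hinj : Function.Injective
      fun δ : {δ : Finset (Fin n) // δ ∈ Δ.weights ∧ δ.card = g.1} => tWeight Δ Y ⟨g, δ⟩ := by
    intro δ δ' h
    refine Subtype.ext (Finset.ext fun i => ?_)
    have := congrFun h i
    simp only [tWeight] at this
    split_ifs at this <;> simp_all
  refine eq_of_sum_eq_of_mem_compV hinj (a := fun δ => Φ'.1.fiber x (tGen Δ ε Y ⟨g, δ⟩))
    (b := fun δ => Φ.1.fiber x (tGen Δ ε Y ⟨g, δ⟩))
    (fun δ => Φ'.2.1.fiber_mem (tGen_mem_compV _) x)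
    (fun δ => Φ.2.1.fiber_mem (tGen_mem_compV _) x) ?_ δ
  rw [← map_sum, ← map_sum]
  exact (hf' x g).symm.trans (hf x g)

/-- A morphism of graded domains is determined by its composition with the covering projection. -/
theorem GradedMor.eq_of_cover_comp_eq {φ φ' : GradedMor Δ ε X Y} {Φ : MultFreeMor Δ ε X Y}
    (h : (cover Δ ε Y).comp Φ.1 = φ.1.comp (cover Δ ε X))
    (h' : (cover Δ ε Y).comp Φ.1 = φ'.1.comp (cover Δ ε X)) : φ' = φ := by
  obtain ⟨hb, hf⟩ := cover_comp_eq_iff.1 h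
  obtain ⟨hb', hf'⟩ := cover_comp_eq_iff.1 h'
  refine Subtype.ext (RingedMor.ext_fiber (hb'.symm.trans hb) fun x => superSym_hom_ext fun g => ?_)
  have hm : ∀ ψ : GradedMor Δ ε X Y, ψ.1.fiber x (superGen _ g) ∈ compU Δ ε X g.1 := fun ψ =>
    ψ.2.fiber_mem (superGen_mem_superComp (xiWeight Δ Y) g) x
  refine sub_eq_zero.1 (coverAlg_injOn XiIndex.le (Submodule.sub_mem _ (hm φ') (hm φ)) ?_)
  rw [map_sub, hf, hf', sub_self]

theorem MultFreeMor.fiber_coverVal_mem (Φ : MultFreeMor Δ ε X Y) (x : X.space)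
    (g : XiIndex Δ Y) : Φ.1.fiber x (coverVal Δ ε Y g) ∈ lengthCompV Δ ε X g.1 := by
  rw [coverVal, map_sum]
  refine Submodule.sum_mem _ fun δ _ => ?_
  refine Submodule.mem_iSup_of_mem (tWeight Δ Y ⟨g, δ⟩) (Submodule.mem_iSup_of_mem ?_ ?_)
  · simp [tWeight, δ.2.2]
  · exact Φ.2.1.fiber_mem (tGen_mem_compV _) x

theorem MultFreeMor.IsInvariant.permV_fiber {Φ : MultFreeMor Δ ε X Y} (hΦ : Φ.IsInvariant)
    (s : Equiv.Perm (Fin n)) (x : X.space) (a : AlgV Δ ε Y) :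
    permV ε s (Φ.1.fiber x a) = Φ.1.fiber x (permV ε s a) :=
  congrFun (congrArg Subtype.val (hΦ s ⊤ (constSection ⊤ a))) ⟨x, trivial⟩

/-- An invariant morphism of multiplicity-free domains descends along the covering projections. -/
theorem MultFreeMor.IsInvariant.exists_descent {Φ : MultFreeMor Δ ε X Y} (hΦ : Φ.IsInvariant) :
    ∃ φ : GradedMor Δ ε X Y, (cover Δ ε Y).comp Φ.1 = φ.1.comp (cover Δ ε X) := by
  -- `R g` does not depend on the point of the base, so applying it preserves smoothness.
  choose R hRmem hR using fun g : XiIndex Δ Y =>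
    exists_coverAlg_leftInverse Δ ε X (XiIndex.le (g := g))
  have hcover : ∀ x g, coverAlg Δ ε X (R g (Φ.1.fiber x (coverVal Δ ε Y g))) =
      Φ.1.fiber x (coverVal Δ ε Y g) := by
    intro x g
    obtain ⟨u, hu, h⟩ := exists_coverAlg_eq_of_invariant (Φ.fiber_coverVal_mem x g) fun s => by
      rw [hΦ.permV_fiber, permV_coverVal]
    rw [← h, hR g u hu]
  -- The images of the generators are taken as global sections: a homomorphism into the algebra of
  -- sections gives smooth dependence on the point for all elements at once, and `θ x` is its
  -- evaluation at `x`.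
  let S : XiIndex Δ Y → sections X.space (AlgU Δ ε X) ⊤ := fun g =>
    ⟨fun x => R g (Φ.1.fiber x.1 (coverVal Δ ε Y g)), (Φ.1.isSection_fiber _).map (R g)⟩
  -- Parity is the additive function `k ↦ k ε` of the weight, so the chosen images supercommute
  -- because they have the right weights.
  let p : ℕ →+ ZMod 2 := (AddMonoidHom.mulRight ε).comp (Nat.castAddMonoidHom (ZMod 2))
  have hS : ∀ g h, S g * S h =
      ((-1 : 𝕜) ^ (xiParity Δ ε Y g * xiParity Δ ε Y h).val) • (S h * S g) := fun g h =>
    Subtype.ext <| funext fun x =>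
      superComp_swap (p := p) (fun _ => rfl) (hRmem g _) (hRmem h _)
  let θ : X.space → AlgU Δ ε Y →ₐ[𝕜] AlgU Δ ε X := fun x =>
    (Pi.evalAlgHom 𝕜 (fun _ : (⊤ : Opens X.space) => AlgU Δ ε X) ⟨x, trivial⟩).comp
      ((sections X.space (AlgU Δ ε X) ⊤).val.comp (superLift S hS))
  have hθgen : ∀ x g, θ x (superGen _ g) = R g (Φ.1.fiber x (coverVal Δ ε Y g)) := by
    intro x g
    simp only [θ, AlgHom.comp_apply, superLift_gen]
    rfl
  have hθmem : ∀ x k, ∀ a ∈ compU Δ ε Y k, θ x a ∈ compU Δ ε X k := by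
    intro x k a ha
    have hv : ∀ g h, θ x (superGen _ g) * θ x (superGen _ h) =
        ((-1 : 𝕜) ^ (xiParity Δ ε Y g * xiParity Δ ε Y h).val) •
          (θ x (superGen _ h) * θ x (superGen _ g)) := fun g h => by
      rw [← map_mul, superGen_swap, map_smul, map_mul]
    have : θ x = superLift (fun g => θ x (superGen _ g)) hv :=
      superSym_hom_ext fun g => (superLift_gen _ hv g).symm
    rw [this]
    refine superLift_mem_superComp hv (fun g => ?_) ha
    rw [hθgen]
    exact hRmem g _
  refine ⟨⟨RingedMor.ofFiber Φ.1.base Φ.1.smooth_base θ fun a => (superLift S hS a).2,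
    fun k W σ hσ x => hθmem _ _ _ (hσ _)⟩, cover_comp_eq_iff.2 ⟨rfl, fun x g => ?_⟩⟩
  change coverAlg Δ ε X (θ x (superGen _ g)) = _
  rw [hθgen, hcover]

end Descent

end MultFree

end

theorem mainTheorem11 {𝕜 : Type*} [RCLike 𝕜] {n : ℕ} (Δ : MultFree.WeightSystem n) (ε : ZMod 2)
    (X₁ X₂ : MultFree.Shape 𝕜) (Φ : MultFree.MultFreeMor Δ ε X₁ X₂) (hΦ : Φ.IsInvariant) :
    ∃! φ : MultFree.GradedMor Δ ε X₁ X₂, MultFree.IsMultFreeLift φ Φ := by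
  obtain ⟨φ, hφ⟩ := hΦ.exists_descent
  exact ⟨φ, ⟨hφ, fun _ h => MultFree.MultFreeMor.eq_of_cover_comp_eq hφ h⟩,
    fun _ h => MultFree.GradedMor.eq_of_cover_comp_eq hφ h.1⟩
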